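/- Let $(V,\{\cdot,\cdot,\cdot\})$ be a finite-dimensional Hermitian positive Jordan triple system, with $T(x,y)z=\{x,y,z\}$, $Q(x)y=\tfrac12\{x,y,x\}$, Bergman operator $B(x,y)=\mathrm{id}-T(x,y)+Q(x)Q(y)$ and trace form $(u\mid v)=\operatorname{tr}T(u,v)$. Let $M\subset V=T_0M$ be the associated Hermitian symmetric space of noncompact type in its circled bounded realization, that is, the connected component of $0$ in the set of all $u\in V$ such that $B(u,u)$ is positive definite with respect to the trace form. If $V$ is simple with genus $g$, the hyperbolic metric $g^{hyp}$ on $M$ is the Kähler metric with Kähler form $\frac{i}{2g}\partial\bar\partial\log K_M$, $K_M(z,\bar w)=\det B(z,w)^{-1}$. Let $M^*$ be the compact dual; its affine chart $M^*\setminus\mathrm{Cut}_0(M^*)$ is identified as usual with $T_0M^*=T_0M=V$, and there the Fubini--Study metric $g^{FS}$ has Kähler form $\frac{i}{2g}\partial\bar\partial\log K_{M^*}$, $K_{M^*}(z,\bar w)=1/K_M(z,-\bar w)$. For general $V$ both metrics are the products of those of the simple factors. A (globally defined) diastatic exponential at $0$ for a Kähler metric with Calabi diastasis $D_0$ is a smooth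 map $\operatorname{Exp}_0$ on the tangent space $V$ at $0$ with $\operatorname{Exp}_0(0)=0$, $(d\operatorname{Exp}_0)_0=\mathrm{id}$ and $D_0(\operatorname{Exp}_0(v))=g_0(v,v)$ for all $v\in V$. A polydisk through $0$ is given by an injective morphism of triple systems $\varphi:\mathbb C^\ell\to V$, where $\mathbb C^\ell$ has the product $\{x,y,z\}_k=2x_k\bar y_kz_k$. There is exactly one diastatic exponential $\operatorname{Exp}_0^{hyp}:T_0M\to M$ for $g^{hyp}$ such that $\operatorname{Exp}_0^{hyp}(\varphi(v))=\varphi\big(\big(\sqrt{1-e^{-|v_k|^2}}\,\tfrac{v_k}{|v_k|}\big)_k\big)$ for every such $\varphi$ and all $v\in\mathbb C^\ell$, and exactly one diastatic exponential $\operatorname{Exp}_0^{FS}:T_0M^*\to M^*\setminus\mathrm{Cut}_0(M^*)$ for $g^{FS}$ such that $\operatorname{Exp}_0^{FS}(\varphi(v))=\varphi\big(\big(\sqrt{e^{|v_k|^2}-1}\,\tfrac{v_k}{|v_k|}\big)_k\big)$ for every such $\varphi$ and all $v$ (a coordinate with $v_k=0$ has the value $0$). The map $\operatorname{Exp}_0^{hyp}:T_0M\to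 M$ is bijective, and the symplectic duality map $\Psi_M(z)=B(z,z)^{-1/4}z$ satisfies $$\Psi_M=\operatorname{Exp}_0^{FS}\circ(\operatorname{Exp}_0^{hyp})^{-1}:M\to M^*\setminus\mathrm{Cut}_0(M^*).$$ Here, for $z\in M$, $B(z,z)^{-1/4}$ is the operator $S$, positive definite with respect to the trace form, with $S^4B(z,z)=\mathrm{id}$. Moreover, every $z\in M$ has a spectral decomposition $z=\sum_{j=1}^s\lambda_jc_j$ with $0<\lambda_1<\dots<\lambda_s$ and pairwise orthogonal nonzero tripotents $c_j$; in any such decomposition all $\lambda_j<1$ and $$\Psi_M(z)=\sum_{j=1}^s\frac{\lambda_j}{(1-\lambda_j^2)^{1/2}}\,c_j .$$ -/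

import Mathlib

open scoped ComplexOrder ContDiff

noncomputable section

/-- A Hermitian Jordan triple system on the complex vector space `V`: a triple product
`{x, y, z} = tp x y z`, `ℂ`-linear in `x` and `z`, antilinear in `y`, symmetric in `x` and `z`,
which satisfies the Jordan identity. -/
structure HermitianJordanTriple (V : Type*) [AddCommGroup V] [Module ℂ V] where
  tp : V →ₗ[ℂ] V →ₛₗ[starRingEnd ℂ] V →ₗ[ℂ] V
  symm : ∀ u v w, tp u v w = tp w v u
  jordan : ∀ x y u v w,
    tp x y (tp u v w) - tp u v (tp x y w) = tp (tp x y u) v w - tp u (tp v x y) w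

namespace HermitianJordanTriple

section Algebra

variable {V : Type*} [AddCommGroup V] [Module ℂ V] (J : HermitianJordanTriple V)

/-- `T(x, y) z = {x, y, z}`. -/
def T (x y : V) : V →ₗ[ℂ] V := J.tp x y

/-- The antilinear operator `Q(x)`, given by `2 Q(x) y = {x, y, x}`. -/
def Q (x : V) : V →ₛₗ[starRingEnd ℂ] V := (1 / 2 : ℂ) • (J.tp x).flip x

/-- The Bergman operator `B(x, y) = id - T(x, y) + Q(x) Q(y)`. -/
def B (x y : V) : V →ₗ[ℂ] V := LinearMap.id - J.T x y + (J.Q x).comp (J.Q y)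

/-- The trace form `(u | v) = tr T(u, v)`. -/
def form (u v : V) : ℂ := LinearMap.trace ℂ V (J.T u v)

/-- The triple system is positive: its trace form is a positive definite Hermitian form. (For a
sesquilinear form, to have real values on the diagonal is the same as to be Hermitian; `0 < a` for
a complex number `a` says that `a` is real and positive.) -/
def IsPositive : Prop := ∀ u : V, u ≠ 0 → 0 < J.form u u

/-- The operator `A` is positive definite with respect to the trace form. -/
def IsPosDef (A : V →ₗ[ℂ] V) : Prop := ∀ u : V, u ≠ 0 → 0 < J.form (A u) u

open Classical in
/-- The power `A ^ (-1/4)` of an operator `A` that is positive definite with respect to the trace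
form: the positive definite operator `S` with `S ^ 4 = A⁻¹`. -/
def negFourthRoot (A : V →ₗ[ℂ] V) : V →ₗ[ℂ] V :=
  if h : ∃ S : V →ₗ[ℂ] V, J.IsPosDef S ∧ S ^ 4 * A = 1 then h.choose else 0

/-- `c` is a tripotent: `{c, c, c} = 2 c`. -/
def IsTripotent (c : V) : Prop := J.tp c c c = (2 : ℂ) • c

/-- (Strong) orthogonality of tripotents: `T(c, d) = 0`. -/
def Orthogonal (c d : V) : Prop := J.T c d = 0

/-- A primitive tripotent: nonzero, and not a sum of two nonzero orthogonal tripotents. -/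
def IsPrimitiveTripotent (c : V) : Prop :=
  J.IsTripotent c ∧ c ≠ 0 ∧
    ∀ d e, J.IsTripotent d → J.IsTripotent e → J.Orthogonal d e → c = d + e → d = 0 ∨ e = 0

/-- An ideal of the triple system. -/
def IsIdeal (I : Submodule ℂ V) : Prop :=
  ∀ x ∈ I, ∀ u v : V, J.tp x u v ∈ I ∧ J.tp u x v ∈ I

/-- A minimal nonzero ideal. The minimal nonzero ideals of a positive system are its simple
components: they correspond to the irreducible factors of the symmetric space. -/
def IsSimpleIdeal (I : Submodule ℂ V) : Prop :=
  J.IsIdeal I ∧ I ≠ ⊥ ∧ ∀ K : Submodule ℂ V, J.IsIdeal K → K ≤ I → K = ⊥ ∨ K = I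

theorem B_mem {I : Submodule ℂ V} (hI : J.IsIdeal I) (z w : V) :
    ∀ x ∈ I, J.B z w x ∈ I := by
  intro x hx
  have h1 : J.tp z w x ∈ I := by
    rw [J.symm]; exact (hI x hx w z).1
  have h2 : J.tp w x w ∈ I := (hI x hx w w).2
  have h3 : J.tp z ((1 / 2 : ℂ) • J.tp w x w) z ∈ I :=
    (hI _ (I.smul_mem _ h2) z z).2
  exact I.add_mem (I.sub_mem hx h1) (I.smul_mem _ h3)

/-- The genus of the irreducible factor given by the simple ideal `I`: the common value of
`tr T(c, c)` at the primitive tripotents `c` of `I` (that is, `2 + a (r - 1) + b` in terms of the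
rank `r` and the multiplicities `a`, `b`). As `T(c, c)` maps `V` to `I`, the trace may be taken
over `V`. -/
def genus (I : Submodule ℂ V) : ℝ :=
  sInf {t : ℝ | ∃ c ∈ I, J.IsPrimitiveTripotent c ∧ t = (J.form c c).re}

/-- The reproducing kernel `K(z, w̄) = 1 / det B(z, w)` of the irreducible factor of the domain
given by the simple ideal `I`; it is holomorphic in `z` and antiholomorphic in `w`. -/
def kernel (I : {I : Submodule ℂ V // J.IsSimpleIdeal I}) (z w : V) : ℂ :=
  (LinearMap.det ((J.B z w).restrict (J.B_mem I.2.1 z w)))⁻¹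

/-- The reproducing kernel of the dual factor: `K*(z, w̄) = 1 / K(z, -w̄)`. -/
def dualKernel (I : {I : Submodule ℂ V // J.IsSimpleIdeal I}) (z w : V) : ℂ :=
  (J.kernel I z (-w))⁻¹

/-- The polarized Kähler potential `Φ(z, w̄)` of the hyperbolic metric of the domain: the sum of
`(1 / g) log K` over the irreducible factors. -/
def hypPotential (z w : V) : ℂ :=
  ∑ᶠ I : {I : Submodule ℂ V // J.IsSimpleIdeal I},
    ((J.genus I.1 : ℂ))⁻¹ * Complex.log (J.kernel I z w)

/-- The polarized Kähler potential of the Fubini-Study metric of the compact dual, on the affine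
chart `V`, the complement of the cut locus of the origin: the sum of `(1 / g) log K*` over the
irreducible factors. -/
def fsPotential (z w : V) : ℂ :=
  ∑ᶠ I : {I : Submodule ℂ V // J.IsSimpleIdeal I},
    ((J.genus I.1 : ℂ))⁻¹ * Complex.log (J.dualKernel I z w)

/-- `φ` is the inclusion, in standard coordinates, of the tangent space `ℂ ^ l` of a polydisk
through the origin: an injective morphism of triple systems, where `ℂ ^ l` has the triple product
`{x, y, z}_k = 2 x_k ȳ_k z_k` of the polydisk `(ℂH¹) ^ l`. -/
def IsPolydisk {l : ℕ} (φ : (Fin l → ℂ) →ₗ[ℂ] V) : Prop :=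
  Function.Injective φ ∧
    ∀ x y z : Fin l → ℂ,
      φ (fun k => 2 * x k * (starRingEnd ℂ) (y k) * z k) = J.tp (φ x) (φ y) (φ z)

/-- A spectral decomposition `z = λ₁ c₁ + ⋯ + λₛ cₛ` with `0 < λ₁ < ⋯ < λₛ` and pairwise
orthogonal nonzero tripotents `c_j`. -/
def IsSpectralDecomposition (z : V) {s : ℕ} (lam : Fin s → ℝ) (c : Fin s → V) : Prop :=
  (∀ j, 0 < lam j) ∧ StrictMono lam ∧ (∀ j, J.IsTripotent (c j) ∧ c j ≠ 0) ∧
    (∀ i j, i ≠ j → J.Orthogonal (c i) (c j)) ∧ z = ∑ j, (lam j : ℂ) • c j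

/-- The symplectic duality map `Ψ(z) = B(z, z) ^ (-1/4) z`. -/
def sympDuality (z : V) : V := J.negFourthRoot (J.B z z) z

end Algebra

end HermitianJordanTriple

/-- Calabi's diastasis `D_p(q)` of the Kähler metric with polarized potential `Φ`. -/
def diastasis {V : Type*} (Φ : V → V → ℂ) (p q : V) : ℝ :=
  (Φ q q + Φ p p - Φ p q - Φ q p).re

/-- The square norm `g_p(v, v)` for the Kähler metric `g` on an open set of `V` whose Kähler form
is `(i / 2) ∂∂̄φ`, where `φ(z) = Φ(z, z̄)`: the value of `∂∂̄φ` at `(v, v̄)`, written with the real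
second derivative `φ''` as `(φ''(v, v) + φ''(iv, iv)) / 4`. -/
def kahlerNormSq {V : Type*} [NormedAddCommGroup V] [NormedSpace ℂ V]
    (Φ : V → V → ℂ) (p v : V) : ℝ :=
  (fderiv ℝ (fderiv ℝ fun z => (Φ z z).re) p v v +
    fderiv ℝ (fderiv ℝ fun z => (Φ z z).re) p (Complex.I • v) (Complex.I • v)) / 4

/-- `E`, defined on the whole tangent space `V` at `0`, is a diastatic exponential at `0` for the
Kähler metric with polarized potential `Φ`: it is smooth, `E 0 = 0`, `(dE)_0 = id`, and
`D_0(E v) = g_0(v, v)`. -/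
structure IsDiastaticExp {V : Type*} [NormedAddCommGroup V] [NormedSpace ℂ V]
    (Φ : V → V → ℂ) (E : V → V) : Prop where
  smooth : ContDiff ℝ ∞ E
  map_zero : E 0 = 0
  deriv_zero : HasFDerivAt E (ContinuousLinearMap.id ℝ V) 0
  diastasis_eq : ∀ v, diastasis Φ 0 (E v) = kahlerNormSq Φ 0 v

/-- The diastatic exponential of the polydisk:
`v ↦ (√(1 - exp(-|v_k|²)) v_k / |v_k|)_k`, with value `0` in the coordinates where `v_k = 0`. -/
def polydiskExp {l : ℕ} (v : Fin l → ℂ) : Fin l → ℂ :=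
  fun k => (Real.sqrt (1 - Real.exp (-‖v k‖ ^ 2)) : ℂ) * (v k / (‖v k‖ : ℂ))

/-- The diastatic exponential of the dual polydisk, in affine coordinates:
`v ↦ (√(exp(|v_k|²) - 1) v_k / |v_k|)_k`, with value `0` in the coordinates where `v_k = 0`. -/
def dualPolydiskExp {l : ℕ} (v : Fin l → ℂ) : Fin l → ℂ :=
  fun k => (Real.sqrt (Real.exp (‖v k‖ ^ 2) - 1) : ℂ) * (v k / (‖v k‖ : ℂ))

namespace HermitianJordanTriple

variable {V : Type*} [NormedAddCommGroup V] [NormedSpace ℂ V] (J : HermitianJordanTriple V)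

/-- The bounded symmetric domain of a positive system, in its circled realization: the connected
component of `0` in the set of all `u` such that `B(u, u)` is positive definite. -/
def domain : Set V := connectedComponentIn {u : V | J.IsPosDef (J.B u u)} 0

/-- `E : V → M` is the diastatic exponential at `0` of the domain `M`: a globally defined diastatic
exponential for the hyperbolic metric with the prescribed restriction to every polydisk. -/
structure IsHypExp (E : V → V) : Prop where
  mem_domain : ∀ v, E v ∈ J.domain
  diastatic : IsDiastaticExp J.hypPotential E
  polydisk : ∀ (l : ℕ) (φ : (Fin l → ℂ) →ₗ[ℂ] V), J.IsPolydisk φ →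
    ∀ v, E (φ v) = φ (polydiskExp v)

/-- `E : V → V` is the diastatic exponential at `0` of the compact dual `M*`, with values in the
affine chart `V`, the complement of the cut locus of `0`: a globally defined diastatic exponential
for the Fubini-Study metric with the prescribed restriction to every dual polydisk. -/
structure IsFSExp (E : V → V) : Prop where
  diastatic : IsDiastaticExp J.fsPotential E
  polydisk : ∀ (l : ℕ) (φ : (Fin l → ℂ) →ₗ[ℂ] V), J.IsPolydisk φ →
    ∀ v, E (φ v) = φ (dualPolydiskExp v)

end HermitianJordanTriple

end

open Module.End

noncomputable section

namespace HermitianJordanTriple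

/-! ### Jordan identities, Peirce eigenvalues and the adjoint of `T`. -/

section AlgebraicLemmas

variable {V : Type*} [AddCommGroup V] [Module ℂ V] (J : HermitianJordanTriple V)

/-! Both exponentials come from one formula, `radial`: the operator √((exp(εs) - 1)/(εs)), evaluated
at s = T(v, v)/2, is applied to v, with ε = -1 for the domain and ε = 1 for the dual. Written this
way it makes sense on all of V, involves no choice of spectral decomposition, and is smooth because
the operator is the positive square root of an entire function of T(v, v)/2
(`IsPositive.contDiff_funCalc`).

Power associativity yields spectral decompositions (`IsPositive.exists_isSpectralDecomposition`), so
every vector lies in a polydisk. This gives uniqueness at once, and on a polydisk `radial` acts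
coordinatewise by the prescribed formulas.

The diastatic property rests on `IsPositive.B_radial`: if z is the image of v, then B(z, -εz) =
exp(ε T(v, v)). It is checked on the joint eigenvectors of the T(c_j, c_j), whose eigenvalues are
natural numbers of sum at most 2. Taking log det over each simple ideal turns the potential, read in
the chart v, into a linear functional of T(v, v), that is, a quadratic form in v. As the chart is
tangent to the identity, the metric at 0 is the same quadratic form (`fderiv_fderiv_of_comp_eq`).

The condition that B(z, z) is positive definite only excludes spectral values equal to 1;
connectedness of the domain keeps them below 1 (`IsPositive.form_one_sub_halfT_pos`). Hence a = √(1
- exp(-t²)) can be solved for t, which gives surjectivity, while T(v, v) = -log B(z, z) gives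
injectivity. Finally B(z, z) c_j = (1 - λ_j²)² c_j, so the duality map sends λ_j to λ_j/√(1 - λ_j²),
and λ_j² = 1 - exp(-t²) turns this into √(exp(t²) - 1). -/

theorem T_apply (x y z : V) : J.T x y z = J.tp x y z := rfl

theorem T_add_left (x x' y : V) : J.T (x + x') y = J.T x y + J.T x' y := by
  ext z; simp [T_apply]

theorem T_add_right (x y y' : V) : J.T x (y + y') = J.T x y + J.T x y' := by
  ext z; simp [T_apply]

theorem T_smul_left (a : ℂ) (x y : V) : J.T (a • x) y = a • J.T x y := by
  ext z; simp [T_apply]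

theorem T_smul_right (a : ℂ) (x y : V) : J.T x (a • y) = (starRingEnd ℂ) a • J.T x y := by
  ext z; simp [T_apply]

theorem T_zero_left (y : V) : J.T 0 y = 0 := by
  ext z; simp [T_apply]

theorem T_zero_right (y : V) : J.T y 0 = 0 := by
  ext z; simp [T_apply]

theorem T_sum_left {ι : Type*} (s : Finset ι) (f : ι → V) (y : V) :
    J.T (∑ i ∈ s, f i) y = ∑ i ∈ s, J.T (f i) y := by
  ext z; simp [T_apply]

theorem T_sum_right {ι : Type*} (s : Finset ι) (f : ι → V) (y : V) :
    J.T y (∑ i ∈ s, f i) = ∑ i ∈ s, J.T y (f i) := by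
  ext z; simp [T_apply]

theorem T_commutator (x y u v : V) :
    J.T x y * J.T u v - J.T u v * J.T x y = J.T (J.tp x y u) v - J.T u (J.tp v x y) := by
  ext w; exact J.jordan x y u v w

theorem Q_apply (x y : V) : J.Q x y = (1 / 2 : ℂ) • J.tp x y x := rfl

theorem B_apply (x y z : V) : J.B x y z = z - J.tp x y z + J.Q x (J.Q y z) := rfl

theorem Q_Q_apply (w u : V) : J.Q w (J.Q w u) = (1 / 4 : ℂ) • J.tp w (J.tp w u w) w := by
  have h : (starRingEnd ℂ) (1 / 2) = 1 / 2 := by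
    rw [map_div₀, map_one, Complex.conj_ofNat]
  simp only [Q_apply, map_smulₛₗ, smul_smul, h]
  norm_num

/-- A case of the Jordan identity that trades T(w, w)² for Q(w)²; it serves both the Peirce
eigenvalues and the Bergman operator. -/
theorem tp_tp_eq (w u : V) :
    J.tp w w (J.tp w w u) =
      (1 / 2 : ℂ) • J.tp (J.tp w w w) w u + (2 : ℂ) • J.Q w (J.Q w u) := by
  have h := J.jordan u w w w w
  rw [J.symm u w w, J.symm u w (J.tp w w w), J.symm (J.tp w w u) w w] at h
  rw [Q_Q_apply, J.symm w u w] at *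
  linear_combination (norm := module) (-(1 / 2 : ℂ)) • h

/-- Two instances of the Jordan identity are linear equations in {x, y, {x, z, x}} and {x, z, {x, y,
x}}; solving them makes both equal to the right-hand side. -/
theorem tp_tp_self (x y z : V) : J.tp x y (J.tp x z x) = J.tp x (J.tp y x z) x := by
  have h1 := J.jordan x y x z x
  have h2 := J.jordan x z x y x
  rw [J.symm (J.tp x y x) z x] at h1
  rw [J.symm (J.tp x z x) y x] at h2
  rw [J.symm z x y] at h1
  linear_combination (norm := module) (-(1 / 3 : ℂ)) • h1 - (2 / 3 : ℂ) • h2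

/-- The image of Q(w) lies in the top Peirce space of w. -/
theorem tp_tp_self_of_cube {w : V} {μ : ℝ} (h : J.tp w w w = ((2 * μ : ℝ) : ℂ) • w) (u : V) :
    J.tp w w (J.tp w u w) = ((2 * μ : ℝ) : ℂ) • J.tp w u w := by
  have h1 := J.jordan w w w u w
  have h2 := J.tp_tp_self w w u
  rw [J.symm u w w, ← h2, h] at h1
  simp only [map_smul, LinearMap.smul_apply] at h1
  linear_combination (norm := module) (1 / 2 : ℂ) • h1

/-- The Peirce eigenvalues of a multiple of a tripotent. -/
theorem eigenvalue_of_cube {w : V} {μ : ℝ} (h : J.tp w w w = ((2 * μ : ℝ) : ℂ) • w) {u : V}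
    (hu : u ≠ 0) {τ : ℂ} (hτ : J.tp w w u = τ • u) : τ = 0 ∨ τ = μ ∨ τ = 2 * μ := by
  have h1 := J.tp_tp_eq w u
  have h2 := J.tp_tp_self_of_cube h (J.tp w u w)
  rw [Q_Q_apply, h] at h1
  simp only [hτ, map_smul, LinearMap.smul_apply] at h1
  have h3 : J.tp w (J.tp w u w) w = (2 * (τ * (τ - μ))) • u := by
    push_cast at h1
    linear_combination (norm := module) (-2 : ℂ) • h1
  rw [h3, map_smul, hτ] at h2
  -- 4 Q(w)² u = 2τ(τ - μ) u lies in the image of Q(w), hence in the 2μ-eigenspace; this is the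
  -- cubic equation for τ.
  have h4 : (2 * (τ * (τ - μ)) * (τ - 2 * μ)) • u = 0 := by
    push_cast at h2
    linear_combination (norm := module) h2
  rcases smul_eq_zero.1 h4 with h5 | h5
  · rcases mul_eq_zero.1 h5 with h6 | h6
    · rcases mul_eq_zero.1 h6 with h7 | h7
      · norm_num at h7
      · rcases mul_eq_zero.1 h7 with h8 | h8
        · exact Or.inl h8
        · exact Or.inr (Or.inl (sub_eq_zero.1 h8))
    · exact Or.inr (Or.inr (sub_eq_zero.1 h6))
  · exact absurd h5 hu

/-! ### The trace form -/

theorem form_add_left (x x' y : V) : J.form (x + x') y = J.form x y + J.form x' y := by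
  simp [form, T_add_left]

theorem form_add_right (x y y' : V) : J.form x (y + y') = J.form x y + J.form x y' := by
  simp [form, T_add_right]

theorem form_smul_left (a : ℂ) (x y : V) : J.form (a • x) y = a * J.form x y := by
  simp [form, T_smul_left]

theorem form_smul_right (a : ℂ) (x y : V) :
    J.form x (a • y) = (starRingEnd ℂ) a * J.form x y := by
  simp [form, T_smul_right]

theorem form_zero_left (y : V) : J.form 0 y = 0 := by
  simp [form, T_zero_left]

theorem form_zero_right (y : V) : J.form y 0 = 0 := by
  simp [form, T_zero_right]

/-- `T(x, y)` and `T(y, x)` are adjoint to each other. -/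
theorem form_tp (x y u v : V) : J.form (J.tp x y u) v = J.form u (J.tp y x v) := by
  -- The trace of a commutator vanishes, so the two terms on the right of the Jordan identity have
  -- equal traces.
  have h := congrArg (LinearMap.trace ℂ V) (J.T_commutator x y u v)
  rw [map_sub, map_sub, LinearMap.trace_mul_comm, sub_self, J.symm v x y] at h
  exact (sub_eq_zero.1 h.symm)

/-- Polarization: the diagonal values at x + y and x + iy give the imaginary and the real part. -/
theorem conj_of_im_diag_eq_zero {F : V → V → ℂ} (hal : ∀ x x' y, F (x + x') y = F x y + F x' y)
    (har : ∀ x y y', F x (y + y') = F x y + F x y')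
    (hsl : ∀ (a : ℂ) x y, F (a • x) y = a * F x y)
    (hsr : ∀ (a : ℂ) x y, F x (a • y) = (starRingEnd ℂ) a * F x y)
    (hF : ∀ x, (F x x).im = 0) (x y : V) : (starRingEnd ℂ) (F x y) = F y x := by
  have h1 := hF (x + y)
  have h2 := hF (x + Complex.I • y)
  simp only [hal, har, hsl, hsr, Complex.add_im, Complex.mul_im, Complex.mul_re, Complex.conj_re,
    Complex.conj_im, Complex.I_re, Complex.I_im, hF] at h1 h2
  apply Complex.ext
  · simp; linarith
  · simp; linarith

variable {J} (hJ : J.IsPositive)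
include hJ

theorem IsPositive.form_self_re_pos {u : V} (hu : u ≠ 0) : 0 < (J.form u u).re :=
  (Complex.lt_def.1 (hJ u hu)).1

theorem IsPositive.form_self_im (u : V) : (J.form u u).im = 0 := by
  by_cases hu : u = 0
  · simp [hu, form_zero_left]
  · exact (Complex.lt_def.1 (hJ u hu)).2.symm

theorem IsPositive.conj_form (u v : V) : (starRingEnd ℂ) (J.form u v) = J.form v u :=
  conj_of_im_diag_eq_zero J.form_add_left J.form_add_right J.form_smul_left J.form_smul_right
    hJ.form_self_im u v

end AlgebraicLemmas

/-! ### Diagonalization of self-adjoint operators -/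

section EigenBasis

variable {V : Type*} [AddCommGroup V] [Module ℂ V]

/-- The trace form of a positive triple system as an inner product. -/
abbrev IsPositive.core {J : HermitianJordanTriple V} (hJ : J.IsPositive) :
    InnerProductSpace.Core ℂ V where
  inner u v := J.form v u
  conj_inner_symm u v := hJ.conj_form u v
  re_inner_nonneg u := by
    by_cases hu : u = 0
    · simp [hu, form_zero_left]
    · exact (hJ.form_self_re_pos hu).le
  add_left u v w := J.form_add_right w u v
  smul_left u v a := J.form_smul_right a v u
  definite u h := by
    by_contra hu
    have := hJ.form_self_re_pos hu
    rw [show J.form u u = 0 from h] at this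
    simp at this

/-- The operator `X` is self-adjoint for the trace form. -/
def IsSelfAdj (J : HermitianJordanTriple V) (X : V →ₗ[ℂ] V) : Prop :=
  ∀ u v, J.form (X u) v = J.form u (X v)

variable [FiniteDimensional ℂ V] {J : HermitianJordanTriple V}

theorem IsPositive.exists_eigenbasis (hJ : J.IsPositive) {X : V →ₗ[ℂ] V} (hX : J.IsSelfAdj X)
    (I : Submodule ℂ V) (hI : ∀ u ∈ I, X u ∈ I) :
    ∃ (n : ℕ) (b : Module.Basis (Fin n) ℂ I) (μ : Fin n → ℝ),
      ∀ i, X (b i) = (μ i : ℂ) • (b i : V) := by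
  let : NormedAddCommGroup V := @InnerProductSpace.Core.toNormedAddCommGroup ℂ V _ _ _ hJ.core
  let : InnerProductSpace ℂ V := InnerProductSpace.ofCore hJ.core.toCore
  have hs : X.IsSymmetric := fun u v => (hX v u).symm
  have hr := hs.restrict_invariant (V := I) hI
  refine ⟨_, (hr.eigenvectorBasis rfl).toBasis, hr.eigenvalues rfl, fun i => ?_⟩
  have := congrArg Subtype.val (hr.apply_eigenvectorBasis rfl i)
  rwa [← OrthonormalBasis.coe_toBasis] at this

/-- Joint eigenvectors of commuting self-adjoint operators span V. Operator identities below are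
therefore checked eigenvalue by eigenvalue. -/
theorem IsPositive.ext_of_joint_eigenvectors (hJ : J.IsPositive) {ι : Type*} {X : ι → V →ₗ[ℂ] V}
    (hX : ∀ i, J.IsSelfAdj (X i)) (hc : ∀ i j, X i * X j = X j * X i) {Y Z : V →ₗ[ℂ] V}
    (h : ∀ (χ : ι → ℂ) (u : V), u ≠ 0 → (∀ i, X i u = χ i • u) → Y u = Z u) : Y = Z := by
  let : NormedAddCommGroup V := @InnerProductSpace.Core.toNormedAddCommGroup ℂ V _ _ _ hJ.core
  let : InnerProductSpace ℂ V := InnerProductSpace.ofCore hJ.core.toCore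
  have hs : ∀ i, (X i).IsSymmetric := fun i u v => (hX i v u).symm
  have htop := LinearMap.IsSymmetric.iSup_iInf_eq_top_of_commute hs (fun i j _ => hc i j)
  rw [← LinearMap.eqLocus_eq_top, eq_top_iff, ← htop]
  refine iSup_le fun χ u hu => ?_
  by_cases hu0 : u = 0
  · simp [hu0]
  · refine h χ u hu0 fun i => ?_
    exact mem_eigenspace_iff.1 ((Submodule.mem_iInf _).1 hu i)

theorem IsPositive.ext_of_eigenvectors (hJ : J.IsPositive) {X : V →ₗ[ℂ] V} (hX : J.IsSelfAdj X)
    {Y Z : V →ₗ[ℂ] V} (h : ∀ (s : ℝ) (u : V), u ≠ 0 → X u = (s : ℂ) • u → Y u = Z u) :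
    Y = Z := by
  obtain ⟨n, b, μ, hb⟩ := hJ.exists_eigenbasis hX ⊤ (fun _ _ => trivial)
  have : Y ∘ₗ (⊤ : Submodule ℂ V).subtype = Z ∘ₗ (⊤ : Submodule ℂ V).subtype := by
    refine b.ext fun i => ?_
    refine h (μ i) (b i) ?_ (hb i)
    simpa using b.ne_zero i
  ext u
  exact LinearMap.congr_fun this ⟨u, trivial⟩

/-- `{w, w, w} = 2 μ w` forces `μ > 0`. -/
theorem IsPositive.pos_of_cube (hJ : J.IsPositive) {w : V} (hw : w ≠ 0) {μ : ℝ}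
    (h : J.tp w w w = ((2 * μ : ℝ) : ℂ) • w) : 0 < μ := by
  have hX : J.IsSelfAdj (J.T w w) := fun u v => J.form_tp w w u v
  obtain ⟨n, b, ν, hb⟩ := hJ.exists_eigenbasis hX ⊤ (fun _ _ => trivial)
  let b' := b.map (Submodule.topEquiv)
  have hb' : ∀ i, J.T w w (b' i) = (ν i : ℂ) • b' i := by
    intro i; simpa [b'] using hb i
  by_contra hμ
  push Not at hμ
  -- The eigenvalues of T(w, w) are 0, μ or 2μ; with μ ≤ 0 their sum (w | w) could not be positive.
  have hν : ∀ i, ν i ≤ 0 := by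
    intro i
    rcases J.eigenvalue_of_cube h (b'.ne_zero i) (hb' i) with h1 | h1 | h1
    · exact le_of_eq (by exact_mod_cast h1)
    · have : ν i = μ := by exact_mod_cast h1
      linarith
    · have : ν i = 2 * μ := by exact_mod_cast h1
      linarith
  have ht : J.form w w = ((∑ i, ν i : ℝ) : ℂ) := by
    rw [form, LinearMap.trace_eq_matrix_trace ℂ b', Matrix.trace]
    push_cast
    refine Finset.sum_congr rfl fun i _ => ?_
    rw [Matrix.diag_apply, LinearMap.toMatrix_apply, hb', map_smul]
    simp
  have := hJ.form_self_re_pos hw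
  rw [ht, Complex.ofReal_re] at this
  exact absurd (Finset.sum_nonpos fun i _ => hν i) (not_le.2 this)

end EigenBasis

/-! ### Functional calculus by interpolation at the eigenvalues -/

section FunctionalCalculus

variable {V : Type*} [AddCommGroup V] [Module ℂ V] [FiniteDimensional ℂ V]

/-- The value of the function `f` at the diagonalizable operator `X` with real eigenvalues. -/
def funCalc (X : V →ₗ[ℂ] V) (f : ℝ → ℝ) : V →ₗ[ℂ] V :=
  Polynomial.aeval X
    (Lagrange.interpolate (finite_hasEigenvalue X).toFinset id (fun s => ((f s.re : ℝ) : ℂ)))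

theorem funCalc_apply {X : V →ₗ[ℂ] V} {s : ℝ} {u : V} (h : X u = (s : ℂ) • u) (f : ℝ → ℝ) :
    funCalc X f u = (f s : ℂ) • u := by
  by_cases hu : u = 0
  · simp [hu]
  · have he : HasEigenvector X (s : ℂ) u := ⟨mem_eigenspace_iff.2 h, hu⟩
    rw [funCalc, aeval_apply_of_hasEigenvector he]
    have hs : (s : ℂ) ∈ (finite_hasEigenvalue X).toFinset := by
      simpa using hasEigenvalue_of_hasEigenvector he
    have := Lagrange.eval_interpolate_at_node (v := id) (fun s => ((f s.re : ℝ) : ℂ))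
      (Function.injective_id.injOn) hs
    simp only [id] at this
    rw [this, Complex.ofReal_re]

variable {J : HermitianJordanTriple V}

theorem IsPositive.funCalc_comp (hJ : J.IsPositive) {X : V →ₗ[ℂ] V} (hX : J.IsSelfAdj X)
    (f g : ℝ → ℝ) : funCalc X f * funCalc X g = funCalc X (fun s => f s * g s) := by
  refine hJ.ext_of_eigenvectors hX fun s u _ h => ?_
  rw [Module.End.mul_apply, funCalc_apply h, map_smul, funCalc_apply h, funCalc_apply h, smul_smul]
  push_cast; ring_nf

omit [FiniteDimensional ℂ V] in
theorem IsPositive.form_eq_zero_of_ne {X : V →ₗ[ℂ] V} (hX : J.IsSelfAdj X)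
    {s t : ℝ} (hst : s ≠ t) {u v : V} (hu : X u = (s : ℂ) • u) (hv : X v = (t : ℂ) • v) :
    J.form u v = 0 := by
  have h := hX u v
  rw [hu, hv, form_smul_left, form_smul_right, Complex.conj_ofReal, ← sub_eq_zero, ← sub_mul] at h
  rcases mul_eq_zero.1 h with h | h
  · exact absurd (by exact_mod_cast sub_eq_zero.1 h) hst
  · exact h

theorem IsPositive.isSelfAdj_funCalc (hJ : J.IsPositive) {X : V →ₗ[ℂ] V} (hX : J.IsSelfAdj X)
    (f : ℝ → ℝ) : J.IsSelfAdj (funCalc X f) := by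
  obtain ⟨n, b, μ, hb⟩ := hJ.exists_eigenbasis hX ⊤ (fun _ _ => trivial)
  have hspan : ∀ p : V → Prop, p 0 → (∀ x y, p x → p y → p (x + y)) →
      (∀ (a : ℂ) x, p x → p (a • x)) → (∀ i, p (b i)) → ∀ u, p u := by
    intro p h0 ha hs hbp u
    have h1 := b.sum_repr ⟨u, trivial⟩
    have h2 := congrArg Subtype.val h1
    simp only [Submodule.coe_sum, Submodule.coe_smul] at h2
    rw [← h2]
    exact Finset.sum_induction _ p ha h0 fun i _ => hs _ _ (hbp i)
  intro u v
  refine hspan (fun u => J.form (funCalc X f u) v = J.form u (funCalc X f v)) ?_ ?_ ?_ ?_ u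
  · simp [form_zero_left]
  · intro x y hx hy; simp [form_add_left, hx, hy]
  · intro a x hx; simp [form_smul_left, hx]
  intro i
  refine hspan (fun v => J.form (funCalc X f (b i)) v = J.form (b i) (funCalc X f v)) ?_ ?_ ?_ ?_ v
  · simp [form_zero_right]
  · intro x y hx hy; simp [form_add_right, hx, hy]
  · intro a x hx; simp [form_smul_right, hx]
  intro j
  rw [funCalc_apply (hb i), funCalc_apply (hb j), form_smul_left, form_smul_right,
    Complex.conj_ofReal]
  by_cases h : μ i = μ j
  · rw [h]
  · rw [IsPositive.form_eq_zero_of_ne hX h (hb i) (hb j)]; simp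

theorem IsPositive.funCalc_one (hJ : J.IsPositive) {X : V →ₗ[ℂ] V} (hX : J.IsSelfAdj X) :
    funCalc X (fun _ => 1) = 1 := by
  refine hJ.ext_of_eigenvectors hX fun s u _ h => ?_
  rw [funCalc_apply h]; simp

/-- A positive function of a selfadjoint operator is positive definite. -/
theorem IsPositive.isPosDef_funCalc (hJ : J.IsPositive) {X : V →ₗ[ℂ] V} (hX : J.IsSelfAdj X)
    {f : ℝ → ℝ} (hf : ∀ s, 0 < f s) : J.IsPosDef (funCalc X f) := by
  intro u hu
  -- f(X) is the square of a self-adjoint invertible operator R, so (f(X)u | u) = (Ru | Ru).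
  have h1 : funCalc X f = funCalc X (fun s => √(f s)) * funCalc X (fun s => √(f s)) := by
    rw [hJ.funCalc_comp hX]; congr; ext s; exact (Real.mul_self_sqrt (hf s).le).symm
  have h2 : funCalc X (fun s => (√(f s))⁻¹) * funCalc X (fun s => √(f s)) = 1 := by
    rw [hJ.funCalc_comp hX, ← hJ.funCalc_one hX]; congr; ext s
    exact inv_mul_cancel₀ (Real.sqrt_pos.2 (hf s)).ne'
  rw [h1, Module.End.mul_apply, hJ.isSelfAdj_funCalc hX]
  refine hJ _ fun h => hu ?_
  rw [← Module.End.one_apply u (R := ℂ), ← h2, Module.End.mul_apply, h, map_zero]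

end FunctionalCalculus

end HermitianJordanTriple


namespace HermitianJordanTriple

/-! ### Power associativity -/

section PowerAssociativity

variable {V : Type*} [AddCommGroup V] [Module ℂ V] (J : HermitianJordanTriple V)

/-- The operator `T(z, z) / 2`. -/
def halfT (z : V) : V →ₗ[ℂ] V := (1 / 2 : ℂ) • J.T z z

theorem T_self_eq (z : V) : J.T z z = (2 : ℂ) • J.halfT z := by
  rw [halfT, smul_smul]; norm_num

theorem tp_self_eq (z u : V) : J.tp z z u = (2 : ℂ) • J.halfT z u := by
  rw [← T_apply, T_self_eq]; rfl

/-- The operator `T` at two odd powers of `z`. -/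
def powT (z : V) (a b : ℕ) : V →ₗ[ℂ] V := J.T ((J.halfT z ^ a) z) ((J.halfT z ^ b) z)

theorem halfT_commutator (z u v : V) :
    J.halfT z * J.T u v - J.T u v * J.halfT z =
      J.T (J.halfT z u) v - J.T u (J.halfT z v) := by
  have h := J.T_commutator z z u v
  rw [J.symm v z z, tp_self_eq, tp_self_eq, T_self_eq, T_smul_left, T_smul_right,
    Complex.conj_ofNat, smul_mul_assoc, mul_smul_comm] at h
  linear_combination (norm := module) (1 / 2 : ℂ) • h

theorem powT_commutator (z : V) (a b : ℕ) :
    J.halfT z * J.powT z a b - J.powT z a b * J.halfT z =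
      J.powT z (a + 1) b - J.powT z a (b + 1) := by
  rw [powT, halfT_commutator, powT, powT, pow_succ', pow_succ']; rfl

/-- The commutator is expanded with the power of z in the acting operator, not in the one acted on.
This is a second relation, independent of `powT_commutator`. -/
theorem powT_commutator' (z : V) (n : ℕ) (h0 : J.powT z 0 n = J.powT z n 0) :
    J.powT z n 0 * J.halfT z - J.halfT z * J.powT z n 0 =
      J.powT z (n + 1) 0 - J.powT z 0 (n + 1) := by
  have h := J.T_commutator ((J.halfT z ^ n) z) z z z
  have h1 : J.tp ((J.halfT z ^ n) z) z z = (2 : ℂ) • (J.halfT z ^ (n + 1)) z := by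
    rw [J.symm, tp_self_eq, pow_succ']; rfl
  have h2 : J.tp z ((J.halfT z ^ n) z) z = (2 : ℂ) • (J.halfT z ^ (n + 1)) z := by
    rw [← h1]; exact LinearMap.congr_fun h0 z
  rw [h1, h2, T_self_eq, T_smul_left, T_smul_right,
    Complex.conj_ofNat, smul_mul_assoc, mul_smul_comm] at h
  have h3 : J.powT z n 0 * J.halfT z - J.halfT z * J.powT z n 0 =
    (1 / 2 : ℂ) • ((2 : ℂ) • (J.powT z (n + 1) 0) - (2 : ℂ) • J.powT z 0 (n + 1)) := by
    simp only [powT, pow_zero, Module.End.one_apply]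
    linear_combination (norm := module) (1 / 2 : ℂ) • h
  rw [h3]; module

theorem powT_eq_and_commute (z : V) (n : ℕ) :
    (∀ a b, a + b = n → J.powT z a b = J.powT z n 0) ∧
      J.halfT z * J.powT z n 0 = J.powT z n 0 * J.halfT z := by
  induction n with
  | zero =>
    refine ⟨fun a b h => ?_, ?_⟩
    · obtain ⟨rfl, rfl⟩ : a = 0 ∧ b = 0 := by omega
      rfl
    · simp only [powT, pow_zero, Module.End.one_apply, T_self_eq, smul_mul_assoc, mul_smul_comm]
  | succ n ih =>
    have h1 : ∀ b a, a + b = n + 1 → J.powT z a b = J.powT z (n + 1) 0 := by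
      intro b
      induction b with
      | zero => intro a h; obtain rfl : a = n + 1 := by omega
                rfl
      | succ b ihb =>
        intro a h
        have h2 := J.powT_commutator z a b
        rw [ih.1 a b (by omega), ih.2, sub_self] at h2
        rw [← sub_eq_zero.1 h2.symm]
        exact ihb _ (by omega)
    refine ⟨fun a b h => h1 b a h, ?_⟩
    -- Each exchange of a factor from left to right costs the same commutator, by the equalities at
    -- level n + 1.
    have h2 : ∀ k, k ≤ n + 2 → J.powT z (n + 2) 0 - J.powT z (n + 2 - k) k =
        (k : ℂ) • (J.halfT z * J.powT z (n + 1) 0 - J.powT z (n + 1) 0 * J.halfT z) := by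
      intro k
      induction k with
      | zero => intro _; simp
      | succ k ihk =>
        intro hk
        have h3 := J.powT_commutator z (n + 2 - (k + 1)) k
        rw [h1 k _ (by omega), show n + 2 - (k + 1) + 1 = n + 2 - k by omega] at h3
        have h4 := ihk (by omega)
        rw [Nat.cast_succ]
        linear_combination (norm := module) h4 - h3
    have h3 := h2 (n + 2) le_rfl
    have h4 := J.powT_commutator' z (n + 1) (h1 (n + 1) 0 (by omega))
    rw [Nat.sub_self] at h3
    -- Telescoping gives n + 2 times the commutator, the second relation gives -1 times it; hence n
    -- + 3 times it is zero.
    have h5 : ((n : ℂ) + 3) • (J.halfT z * J.powT z (n + 1) 0 -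
        J.powT z (n + 1) 0 * J.halfT z) = 0 := by
      push_cast at h3
      linear_combination (norm := module) - h3 - h4
    rcases smul_eq_zero.1 h5 with h6 | h6
    · exact absurd h6 (by exact_mod_cast (Nat.succ_ne_zero (n + 2)))
    · exact sub_eq_zero.1 h6

/-- Polynomials are the form needed later: the spectral components of z are polynomials in `J.halfT
z` applied to z. -/
theorem halfT_commute_T_aeval (z : V) (p q : Polynomial ℂ) :
    J.halfT z * J.T (Polynomial.aeval (J.halfT z) p z) (Polynomial.aeval (J.halfT z) q z) =
      J.T (Polynomial.aeval (J.halfT z) p z) (Polynomial.aeval (J.halfT z) q z) * J.halfT z := by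
  rw [Polynomial.aeval_eq_sum_range, Polynomial.aeval_eq_sum_range, LinearMap.sum_apply,
    LinearMap.sum_apply, T_sum_left, Finset.mul_sum, Finset.sum_mul]
  refine Finset.sum_congr rfl fun a _ => ?_
  rw [T_sum_right, Finset.mul_sum, Finset.sum_mul]
  refine Finset.sum_congr rfl fun b _ => ?_
  rw [LinearMap.smul_apply, LinearMap.smul_apply, T_smul_left, T_smul_right, mul_smul_comm,
    mul_smul_comm, smul_mul_assoc, smul_mul_assoc]
  have h := J.powT_eq_and_commute z (a + b)
  rw [← h.1 a b rfl] at h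
  exact congrArg _ (congrArg _ h.2)

end PowerAssociativity

/-! ### Spectral decompositions and polydisks -/

section Spectral

variable {V : Type*} [AddCommGroup V] [Module ℂ V] (J : HermitianJordanTriple V)

/-- A family of pairwise orthogonal tripotents. -/
def IsOrthoSystem {ι : Type*} (c : ι → V) : Prop :=
  (∀ j, J.IsTripotent (c j)) ∧ ∀ i j, i ≠ j → J.Orthogonal (c i) (c j)

theorem isSelfAdj_T (z : V) : J.IsSelfAdj (J.T z z) := fun u v => J.form_tp z z u v

theorem isSelfAdj_halfT (z : V) : J.IsSelfAdj (J.halfT z) := fun u v => by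
  rw [halfT, LinearMap.smul_apply, LinearMap.smul_apply, form_smul_left, form_smul_right,
    J.isSelfAdj_T, map_div₀, map_one, Complex.conj_ofNat]

variable {J}

theorem IsPositive.exists_isSpectralDecomposition [FiniteDimensional ℂ V] (hJ : J.IsPositive)
    (z : V) : ∃ (s : ℕ) (lam : Fin s → ℝ) (c : Fin s → V), J.IsSpectralDecomposition z lam c := by
  classical
  let A := J.halfT z
  have hA : J.IsSelfAdj A := J.isSelfAdj_halfT z
  -- The component of z in the r-eigenspace of T(z, z)/2.
  let y : ℝ → V := fun r => funCalc A (fun t => if t = r then 1 else 0) z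
  let R : Finset ℝ := ((finite_hasEigenvalue A).toFinset.image Complex.re).filter
    (fun r => y r ≠ 0)
  have hAy : ∀ r, A (y r) = (r : ℂ) • y r := by
    intro r
    suffices h : A * funCalc A (fun t => if t = r then 1 else 0) =
        (r : ℂ) • funCalc A (fun t => if t = r then 1 else 0) from LinearMap.congr_fun h z
    refine hJ.ext_of_eigenvectors hA fun s u _ hu => ?_
    rw [Module.End.mul_apply, LinearMap.smul_apply, funCalc_apply hu, map_smul, hu]
    by_cases h : s = r <;> simp [h]
  have hsum : z = ∑ r ∈ R, y r := by
    rw [Finset.sum_filter_ne_zero]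
    suffices h : (1 : V →ₗ[ℂ] V) = ∑ r ∈ (finite_hasEigenvalue A).toFinset.image Complex.re,
        funCalc A (fun t => if t = r then 1 else 0) by
      have := LinearMap.congr_fun h z
      rwa [LinearMap.sum_apply] at this
    refine hJ.ext_of_eigenvectors hA fun s u hu0 hu => ?_
    have hs : s ∈ (finite_hasEigenvalue A).toFinset.image Complex.re := by
      refine Finset.mem_image.2 ⟨(s : ℂ), ?_, Complex.ofReal_re s⟩
      simpa using hasEigenvalue_of_hasEigenvector ⟨mem_eigenspace_iff.2 hu, hu0⟩
    rw [LinearMap.sum_apply, Finset.sum_congr rfl fun r _ => funCalc_apply hu _,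
      Finset.sum_eq_single s]
    · simp
    · intro r _ hr; simp [hr.symm]
    · intro h; exact absurd hs h
  -- The commutator of T(z, z)/2 with T(y_r, y_r') is (r - r') T(y_r, y_r'), and it vanishes by
  -- power associativity.
  have horth : ∀ r r', r ≠ r' → J.T (y r) (y r') = 0 := by
    intro r r' hr
    have h1 := J.halfT_commutator z (y r) (y r')
    have h2 : J.halfT z * J.T (y r) (y r') = J.T (y r) (y r') * J.halfT z :=
      J.halfT_commute_T_aeval z _ _
    have h3 : ((r : ℂ) - r') • J.T (y r) (y r') = 0 := by
      rw [h2, sub_self, hAy, hAy, T_smul_left, T_smul_right, Complex.conj_ofReal] at h1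
      rw [sub_smul, ← h1]
    rcases smul_eq_zero.1 h3 with h4 | h4
    · exact absurd (by exact_mod_cast sub_eq_zero.1 h4) hr
    · exact h4
  have hcube : ∀ r ∈ R, J.tp (y r) (y r) (y r) = ((2 * r : ℝ) : ℂ) • y r := by
    intro r hr
    have h1 : J.T z z (y r) = (2 : ℂ) • ((r : ℂ) • y r) := by
      rw [T_self_eq, LinearMap.smul_apply]; exact congrArg _ (hAy r)
    -- By orthogonality and the symmetry in the outer variables, only the (r, r) term of the double
    -- sum acts on y_r.
    have h2 : J.T z z (y r) = J.T (y r) (y r) (y r) := by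
      conv_lhs => rw [hsum]
      rw [T_sum_left, LinearMap.sum_apply, Finset.sum_eq_single r]
      · rw [T_sum_right, LinearMap.sum_apply, Finset.sum_eq_single r]
        · intro r' _ h; rw [horth _ _ h.symm]; rfl
        · intro h; exact absurd hr h
      · intro r' _ h
        rw [T_sum_right, LinearMap.sum_apply]
        refine Finset.sum_eq_zero fun r'' _ => ?_
        by_cases h' : r' = r''
        · rw [T_apply, J.symm, ← T_apply, horth _ _ (h' ▸ h.symm)]; rfl
        · rw [horth _ _ h']; rfl
      · intro h; exact absurd hr h
    rw [← T_apply, ← h2, h1, smul_smul]; push_cast; rfl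
  -- This also shows that z has no component in the kernel.
  have hpos : ∀ r ∈ R, 0 < r := fun r hr =>
    hJ.pos_of_cube (Finset.mem_filter.1 hr).2 (hcube r hr)
  let o := R.orderIsoOfFin rfl
  have hop : ∀ j, 0 < (o j : ℝ) := fun j => hpos _ (o j).2
  -- Since {y, y, y} = 2r y, the vector y/√r is a tripotent, with coefficient √r in z; the order
  -- isomorphism lists the r increasingly.
  refine ⟨R.card, fun j => √(o j : ℝ), fun j => (((√(o j : ℝ))⁻¹ : ℝ) : ℂ) • y (o j), ?_, ?_, ?_,
    ?_, ?_⟩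
  · exact fun j => Real.sqrt_pos.2 (hop j)
  · intro i j hij
    exact Real.sqrt_lt_sqrt (hop i).le (o.strictMono hij)
  · intro j
    have hsq : √(o j : ℝ) ≠ 0 := (Real.sqrt_pos.2 (hop j)).ne'
    constructor
    · have h := hcube _ (o j).2
      have ha : (√(o j : ℝ))⁻¹ * (√(o j : ℝ))⁻¹ * (o j : ℝ) = 1 := by
        rw [← mul_inv, Real.mul_self_sqrt (hop j).le, inv_mul_cancel₀ (hop j).ne']
      change J.T ((((√(o j : ℝ))⁻¹ : ℝ) : ℂ) • y (o j)) ((((√(o j : ℝ))⁻¹ : ℝ) : ℂ) • y (o j))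
        ((((√(o j : ℝ))⁻¹ : ℝ) : ℂ) • y (o j)) = (2 : ℂ) • ((((√(o j : ℝ))⁻¹ : ℝ) : ℂ) • y (o j))
      generalize (√(o j : ℝ))⁻¹ = a at ha
      rw [T_smul_left, T_smul_right, LinearMap.smul_apply, LinearMap.smul_apply, map_smul,
        T_apply, h, smul_smul, smul_smul, smul_smul, smul_smul, Complex.conj_ofReal]
      congr 1
      have : (a : ℂ) * a * (o j : ℝ) = 1 := by exact_mod_cast ha
      push_cast
      linear_combination (2 * (a : ℂ)) * this
    · refine smul_ne_zero (by exact_mod_cast inv_ne_zero hsq) (Finset.mem_filter.1 (o j).2).2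
  · intro i j hij
    have : (o i : ℝ) ≠ o j := fun h => hij (o.injective (Subtype.ext h))
    rw [Orthogonal, T_smul_left, T_smul_right, horth _ _ this, smul_zero, smul_zero]
  · conv_lhs => rw [hsum]
    rw [← Finset.sum_coe_sort, ← o.toEquiv.sum_comp]
    refine Finset.sum_congr rfl fun j _ => ?_
    have hsq : √(o j : ℝ) ≠ 0 := (Real.sqrt_pos.2 (hop j)).ne'
    rw [smul_smul, ← Complex.ofReal_mul, mul_inv_cancel₀ hsq, Complex.ofReal_one, one_smul]
    rfl

theorem IsOrthoSystem.T_sum_sum {l : ℕ} {c : Fin l → V} (hc : J.IsOrthoSystem c)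
    (a b : Fin l → ℂ) :
    J.T (∑ j, a j • c j) (∑ j, b j • c j) =
      ∑ j, (a j * (starRingEnd ℂ) (b j)) • J.T (c j) (c j) := by
  rw [T_sum_left]
  refine Finset.sum_congr rfl fun i _ => ?_
  rw [T_sum_right, Finset.sum_eq_single i]
  · rw [T_smul_left, T_smul_right, smul_smul]
  · intro j _ hj
    rw [T_smul_left, T_smul_right, hc.2 _ _ hj.symm, smul_zero, smul_zero]
  · simp

theorem IsOrthoSystem.tp_same_ne {l : ℕ} {c : Fin l → V} (hc : J.IsOrthoSystem c)
    {i j : Fin l} (h : j ≠ i) : J.tp (c i) (c i) (c j) = 0 := by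
  rw [J.symm, ← T_apply, hc.2 _ _ h]; rfl

theorem IsOrthoSystem.T_sum_sum_apply {l : ℕ} {c : Fin l → V} (hc : J.IsOrthoSystem c)
    (a b : Fin l → ℂ) (i : Fin l) :
    J.T (∑ j, a j • c j) (∑ j, b j • c j) (c i) = (2 * (a i * (starRingEnd ℂ) (b i))) • c i := by
  rw [hc.T_sum_sum, LinearMap.sum_apply, Finset.sum_eq_single i]
  · rw [LinearMap.smul_apply, T_apply, hc.1 i, smul_smul, mul_comm]
  · intro j _ h
    rw [LinearMap.smul_apply, T_apply, hc.tp_same_ne h.symm, smul_zero]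
  · simp

theorem IsOrthoSystem.tp_sum {l : ℕ} {c : Fin l → V} (hc : J.IsOrthoSystem c)
    (a b d : Fin l → ℂ) :
    J.tp (∑ j, a j • c j) (∑ j, b j • c j) (∑ j, d j • c j) =
      ∑ j, (2 * a j * (starRingEnd ℂ) (b j) * d j) • c j := by
  rw [← T_apply, map_sum]
  refine Finset.sum_congr rfl fun i _ => ?_
  rw [map_smul, hc.T_sum_sum_apply, smul_smul]
  ring_nf

theorem IsOrthoSystem.isPolydisk {l : ℕ} {c : Fin l → V} (hc : J.IsOrthoSystem c)
    (h0 : ∀ j, c j ≠ 0) : J.IsPolydisk (Fintype.linearCombination ℂ c) := by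
  have happ : ∀ x : Fin l → ℂ, Fintype.linearCombination ℂ c x = ∑ j, x j • c j := fun _ => rfl
  constructor
  · rw [← LinearMap.ker_eq_bot, LinearMap.ker_eq_bot']
    intro x hx
    rw [happ] at hx
    funext i
    -- T(c_i, c_i) picks out the i-th coordinate, whence injectivity.
    have h1 : J.tp (c i) (c i) (∑ j, x j • c j) = (2 * x i) • c i := by
      rw [map_sum, Finset.sum_eq_single i]
      · rw [map_smul, hc.1 i, smul_smul, mul_comm]
      · intro j _ h; rw [map_smul, hc.tp_same_ne h, smul_zero]
      · simp
    rw [hx, map_zero] at h1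
    simpa [h0 i] using h1.symm
  · intro x y z
    simp only [happ, hc.tp_sum]

theorem IsPolydisk.halfT_apply {l : ℕ} {φ : (Fin l → ℂ) →ₗ[ℂ] V} (hφ : J.IsPolydisk φ)
    (v : Fin l → ℂ) (k : Fin l) :
    J.halfT (φ v) (φ (Pi.single k 1)) = ((‖v k‖ ^ 2 : ℝ) : ℂ) • φ (Pi.single k 1) := by
  rw [halfT, LinearMap.smul_apply, T_apply, ← hφ.2, ← map_smul, ← map_smul]
  congr 1
  funext j
  by_cases h : j = k
  · subst h
    simp [mul_assoc, Complex.mul_conj, Complex.normSq_eq_norm_sq]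
  · simp [h]

end Spectral

end HermitianJordanTriple


/-! ### Scalar identities -/

/-- The entire function `(exp s - 1) / s`. -/
def expQuot (s : ℝ) : ℝ := dslope Real.exp 0 s

theorem mul_expQuot (s : ℝ) : s * expQuot s = Real.exp s - 1 := by
  have := sub_smul_dslope Real.exp 0 s
  simpa [expQuot] using this

theorem expQuot_zero : expQuot 0 = 1 := by
  simp [expQuot]

theorem expQuot_pos (s : ℝ) : 0 < expQuot s := by
  rcases lt_trichotomy s 0 with h | h | h
  · have h1 := mul_expQuot s
    have h2 : Real.exp s < 1 := Real.exp_lt_one_iff.mpr h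
    by_contra h3
    nlinarith [mul_nonneg_of_nonpos_of_nonpos h.le (not_lt.1 h3)]
  · rw [h, expQuot_zero]; exact one_pos
  · have h1 := mul_expQuot s
    have h2 : 1 < Real.exp s := Real.one_lt_exp_iff.2 h
    by_contra h3
    nlinarith [mul_nonpos_of_nonneg_of_nonpos h.le (not_lt.1 h3)]

theorem expQuot_mul_sq {ε : ℝ} (hε : ε ^ 2 = 1) (r : ℝ) :
    expQuot (ε * r ^ 2) * r ^ 2 = ε * (Real.exp (ε * r ^ 2) - 1) := by
  rw [← mul_expQuot]; linear_combination (-(r ^ 2 * expQuot (ε * r ^ 2))) * hε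

theorem sqrt_expQuot_mul {ε : ℝ} (hε : ε ^ 2 = 1) {r : ℝ} (hr : 0 ≤ r) :
    √(expQuot (ε * r ^ 2)) * r = √(ε * (Real.exp (ε * r ^ 2) - 1)) := by
  rw [← expQuot_mul_sq hε, Real.sqrt_mul (expQuot_pos _).le, Real.sqrt_sq hr]

/-- Removes the division by |x| from both polydisk formulas; at x = 0 both sides vanish, as division
by zero gives 0. -/
theorem sqrt_expQuot_smul {ε : ℝ} (hε : ε ^ 2 = 1) (x : ℂ) :
    (√(ε * (Real.exp (ε * ‖x‖ ^ 2) - 1)) : ℂ) * (x / (‖x‖ : ℂ)) =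
      (√(expQuot (ε * ‖x‖ ^ 2)) : ℂ) * x := by
  rw [← sqrt_expQuot_mul hε (norm_nonneg x)]
  by_cases hx : x = 0
  · simp [hx]
  · have : (‖x‖ : ℂ) ≠ 0 := by exact_mod_cast norm_ne_zero_iff.2 hx
    push_cast
    field_simp

theorem polydiskExp_eq {l : ℕ} (v : Fin l → ℂ) (k : Fin l) :
    polydiskExp v k = (√(expQuot (-1 * ‖v k‖ ^ 2)) : ℂ) * v k := by
  rw [← sqrt_expQuot_smul (by norm_num), polydiskExp]
  congr 4
  simp

theorem dualPolydiskExp_eq {l : ℕ} (v : Fin l → ℂ) (k : Fin l) :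
    dualPolydiskExp v k = (√(expQuot (1 * ‖v k‖ ^ 2)) : ℂ) * v k := by
  rw [← sqrt_expQuot_smul (by norm_num), dualPolydiskExp]
  congr 4
  simp

/-- With at most two factors, the product is 1 + e₁ + e₂, and e₂ = (p₁² - p₂)/2 in power sums. This
is how the quadratic expression B becomes a product. -/
theorem prod_one_add_pow_of_card_le_two {ι : Type*} [Fintype ι] (n : ι → ℕ) (hn : ∑ i, n i ≤ 2)
    (x : ι → ℂ) :
    ∏ i, (1 + x i) ^ n i =
      1 + ∑ i, n i * x i + (1 / 2) * (∑ i, n i * x i) ^ 2 - (1 / 2) * ∑ i, n i * x i ^ 2 := by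
  classical
  obtain ⟨m, hm⟩ : ∃ m : Multiset ι, m = ∑ i, n i • ({i} : Multiset ι) := ⟨_, rfl⟩
  have hcard : m.card ≤ 2 := by
    rw [hm, Multiset.card_sum]; simpa using hn
  have hsum : ∀ f : ι → ℂ, ∑ i, n i * f i = (m.map f).sum := by
    intro f
    have := map_sum ((Multiset.sumAddMonoidHom (M := ℂ)).comp (Multiset.mapAddMonoidHom f))
      (fun i => n i • ({i} : Multiset ι)) Finset.univ
    rw [← hm] at this
    simp only [map_nsmul, AddMonoidHom.comp_apply, Multiset.coe_mapAddMonoidHom,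
      Multiset.coe_sumAddMonoidHom, Multiset.map_singleton, Multiset.sum_singleton,
      nsmul_eq_mul] at this
    exact this.symm
  have hprod : ∏ i, (1 + x i) ^ n i = (m.map fun i => 1 + x i).prod := by
    rw [hm, ← Multiset.coe_mapAddMonoidHom, map_sum, Multiset.prod_sum]
    refine Finset.prod_congr rfl fun i _ => ?_
    rw [map_nsmul, Multiset.prod_nsmul]; simp
  rw [hprod, hsum, hsum]
  clear hm hsum hprod
  interval_cases h : m.card
  · rw [Multiset.card_eq_zero] at h; simp [h]
  · obtain ⟨a, rfl⟩ := Multiset.card_eq_one.1 h; simp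
  · obtain ⟨a, b, rfl⟩ := Multiset.card_eq_two.1 h; simp; ring

namespace HermitianJordanTriple

variable {V : Type*} [AddCommGroup V] [Module ℂ V] {J : HermitianJordanTriple V}

/-! ### The Bergman operator on joint Peirce spaces -/

section Bergman

variable (J)

theorem Q_Q_eq (z u : V) : J.Q z (J.Q z u) =
    (1 / 2 : ℂ) • J.T z z (J.T z z u) - (1 / 4 : ℂ) • J.T (J.tp z z z) z u := by
  have h := J.tp_tp_eq z u
  simp only [T_apply]
  linear_combination (norm := module) (-(1 / 2 : ℂ)) • h

theorem B_neg_smul_apply {ε : ℝ} (hε : ε ^ 2 = 1) (z u : V) :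
    J.B z (-((ε : ℂ) • z)) u = u + (ε : ℂ) • J.T z z u + J.Q z (J.Q z u) := by
  have h : J.Q (-((ε : ℂ) • z)) u = J.Q z u := by
    have : (ε : ℂ) * ε = 1 := by rw [← sq]; exact_mod_cast hε
    simp only [Q_apply, map_neg, map_smul, LinearMap.neg_apply, LinearMap.smul_apply, smul_neg,
      neg_neg]
    rw [smul_smul (ε : ℂ), this, one_smul]
  rw [B_apply, h, map_neg, LinearMap.map_smulₛₗ, LinearMap.neg_apply, LinearMap.smul_apply,
    Complex.conj_ofReal, sub_neg_eq_add, T_apply]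

variable {J}

theorem IsOrthoSystem.T_real {l : ℕ} {c : Fin l → V} (hc : J.IsOrthoSystem c) (a : Fin l → ℝ) :
    J.T (∑ j, (a j : ℂ) • c j) (∑ j, (a j : ℂ) • c j) =
      ∑ j, ((a j ^ 2 : ℝ) : ℂ) • J.T (c j) (c j) := by
  rw [hc.T_sum_sum]
  refine Finset.sum_congr rfl fun j _ => ?_
  rw [Complex.conj_ofReal, ← Complex.ofReal_mul, sq]

/-- Here B = 1 + εT(z, z) + Q(z)², and Q(z)² = T(z, z)²/2 - T({z, z, z}, z)/4 acts on u through the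
power sums of the a_j². -/
theorem IsOrthoSystem.B_apply_of_joint {l : ℕ} {c : Fin l → V} (hc : J.IsOrthoSystem c)
    (a : Fin l → ℝ) {ε : ℝ} (hε : ε ^ 2 = 1) {n : Fin l → ℕ} (hn : ∑ j, n j ≤ 2) {u : V}
    (hu : ∀ j, J.T (c j) (c j) u = (n j : ℂ) • u) :
    J.B (∑ j, (a j : ℂ) • c j) (-((ε : ℂ) • ∑ j, (a j : ℂ) • c j)) u =
      (∏ j, (1 + (ε : ℂ) * (a j : ℂ) ^ 2) ^ n j) • u := by
  have h1 : J.T (∑ j, (a j : ℂ) • c j) (∑ j, (a j : ℂ) • c j) u =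
      (∑ j, (n j : ℂ) * (a j : ℂ) ^ 2) • u := by
    rw [hc.T_real, LinearMap.sum_apply, Finset.sum_smul]
    refine Finset.sum_congr rfl fun j _ => ?_
    rw [LinearMap.smul_apply, hu, smul_smul]; push_cast; ring_nf
  have h2 : J.T (J.tp (∑ j, (a j : ℂ) • c j) (∑ j, (a j : ℂ) • c j) (∑ j, (a j : ℂ) • c j))
      (∑ j, (a j : ℂ) • c j) u = (2 * ∑ j, (n j : ℂ) * (a j : ℂ) ^ 4) • u := by
    rw [hc.tp_sum, hc.T_sum_sum, LinearMap.sum_apply, Finset.mul_sum, Finset.sum_smul]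
    refine Finset.sum_congr rfl fun j _ => ?_
    rw [LinearMap.smul_apply, hu, smul_smul, Complex.conj_ofReal]; ring_nf
  have hε' : (ε : ℂ) ^ 2 = 1 := by exact_mod_cast hε
  rw [B_neg_smul_apply J hε, Q_Q_eq, h1, map_smul, h1, h2, prod_one_add_pow_of_card_le_two n hn]
  have h3 : ∑ j, (n j : ℂ) * ((ε : ℂ) * (a j : ℂ) ^ 2) = ε * ∑ j, (n j : ℂ) * (a j : ℂ) ^ 2 := by
    rw [Finset.mul_sum]; exact Finset.sum_congr rfl fun j _ => by ring
  have h4 : ∑ j, (n j : ℂ) * ((ε : ℂ) * (a j : ℂ) ^ 2) ^ 2 = ∑ j, (n j : ℂ) * (a j : ℂ) ^ 4 :=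
    Finset.sum_congr rfl fun j _ => by rw [mul_pow, hε']; ring
  rw [h3, h4, mul_pow, hε']
  module

theorem IsOrthoSystem.T_commute {l : ℕ} {c : Fin l → V} (hc : J.IsOrthoSystem c) (i j : Fin l) :
    J.T (c i) (c i) * J.T (c j) (c j) = J.T (c j) (c j) * J.T (c i) (c i) := by
  by_cases h : i = j
  · rw [h]
  · have h1 := J.T_commutator (c i) (c i) (c j) (c j)
    have h2 : J.tp (c j) (c i) (c i) = 0 := by
      rw [← T_apply, hc.2 _ _ (Ne.symm h)]; rfl
    rw [hc.tp_same_ne (Ne.symm h), h2, T_zero_left, T_zero_right, sub_zero] at h1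
    exact sub_eq_zero.1 h1

theorem IsTripotent.eigenvalue {c : V} (hc : J.IsTripotent c) {u : V} (hu : u ≠ 0) {τ : ℂ}
    (hτ : J.T c c u = τ • u) : ∃ n : ℕ, n ≤ 2 ∧ τ = n := by
  have h : J.tp c c c = ((2 * (1 : ℝ) : ℝ) : ℂ) • c := by
    rw [hc]; norm_num
  rcases J.eigenvalue_of_cube h hu hτ with h | h | h
  · exact ⟨0, by norm_num, by simpa using h⟩
  · exact ⟨1, by norm_num, by simpa using h⟩
  · exact ⟨2, by norm_num, by simpa using h⟩

theorem IsOrthoSystem.isTripotent_sum {l : ℕ} {c : Fin l → V} (hc : J.IsOrthoSystem c) :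
    J.IsTripotent (∑ j, c j) := by
  have := hc.tp_sum (fun _ => 1) (fun _ => 1) (fun _ => 1)
  simp only [one_smul, map_one, mul_one] at this
  rw [IsTripotent, this, Finset.smul_sum]

/-- A joint eigenvector of the operators `T(c_j, c_j)` lies in a joint Peirce space. -/
theorem IsOrthoSystem.joint_eigenvalue {l : ℕ} {c : Fin l → V} (hc : J.IsOrthoSystem c) {u : V}
    (hu : u ≠ 0) {χ : Fin l → ℂ} (h : ∀ j, J.T (c j) (c j) u = χ j • u) :
    ∃ n : Fin l → ℕ, ∑ j, n j ≤ 2 ∧ ∀ j, χ j = n j := by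
  choose n _ hn using fun j => (hc.1 j).eigenvalue hu (h j)
  -- The sum of the c_j is again a tripotent, so the total of the n_j is one of its Peirce
  -- eigenvalues 0, 1, 2.
  have h1 : J.T (∑ j, c j) (∑ j, c j) u = ((∑ j, n j : ℕ) : ℂ) • u := by
    have := hc.T_sum_sum (fun _ => 1) (fun _ => 1)
    simp only [one_smul, map_one, mul_one] at this
    rw [this, LinearMap.sum_apply, Nat.cast_sum, Finset.sum_smul]
    exact Finset.sum_congr rfl fun j _ => by rw [h, hn]
  obtain ⟨m, hm, hm'⟩ := hc.isTripotent_sum.eigenvalue hu h1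
  exact ⟨n, by rw [show ∑ j, n j = m by exact_mod_cast hm']; exact hm, hn⟩

end Bergman

/-! ### The common formula for both exponentials -/

section Radial

variable [FiniteDimensional ℂ V]

/-- The candidate for the diastatic exponential, of the domain for `ε = -1` and of its dual for
`ε = 1`. -/
def radial (J : HermitianJordanTriple V) (ε : ℝ) (v : V) : V :=
  funCalc (J.halfT v) (fun s => √(expQuot (ε * s))) v

omit [FiniteDimensional ℂ V] in
theorem IsPolydisk.apply_eq_sum {l : ℕ} {φ : (Fin l → ℂ) →ₗ[ℂ] V} (v : Fin l → ℂ) :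
    φ v = ∑ k, v k • φ (Pi.single k 1) := by
  conv_lhs => rw [pi_eq_sum_univ' v, map_sum]
  simp

/-- The images of the coordinate vectors are eigenvectors of T(φv, φv)/2 with eigenvalues |v_k|². -/
theorem IsPolydisk.radial_apply {l : ℕ} {φ : (Fin l → ℂ) →ₗ[ℂ] V} (hφ : J.IsPolydisk φ) (ε : ℝ)
    (v : Fin l → ℂ) :
    J.radial ε (φ v) = φ (fun k => (√(expQuot (ε * ‖v k‖ ^ 2)) : ℂ) * v k) := by
  suffices h : ∀ f : ℝ → ℝ, funCalc (J.halfT (φ v)) f (∑ k, v k • φ (Pi.single k 1)) =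
      φ (fun k => (f (‖v k‖ ^ 2) : ℂ) * v k) by
    rw [← IsPolydisk.apply_eq_sum] at h; exact h _
  intro f
  rw [map_sum, IsPolydisk.apply_eq_sum (φ := φ) (fun k => (f (‖v k‖ ^ 2) : ℂ) * v k)]
  refine Finset.sum_congr rfl fun k _ => ?_
  rw [map_smul, funCalc_apply (hφ.halfT_apply v k), smul_smul, mul_comm]

theorem IsOrthoSystem.radial_sum {l : ℕ} {c : Fin l → V} (hc : J.IsOrthoSystem c)
    (h0 : ∀ j, c j ≠ 0) (ε : ℝ) (a : Fin l → ℝ) :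
    J.radial ε (∑ j, (a j : ℂ) • c j) =
      ∑ j, ((√(expQuot (ε * a j ^ 2)) * a j : ℝ) : ℂ) • c j := by
  have := (hc.isPolydisk h0).radial_apply ε (fun j => (a j : ℂ))
  simp only [Fintype.linearCombination_apply, Complex.norm_real, Real.norm_eq_abs, sq_abs] at this
  rw [this]
  push_cast
  rfl

theorem IsPositive.exists_orthoSystem (hJ : J.IsPositive) (v : V) :
    ∃ (l : ℕ) (a : Fin l → ℝ) (c : Fin l → V), J.IsOrthoSystem c ∧ (∀ j, c j ≠ 0) ∧
      (∀ j, 0 < a j) ∧ v = ∑ j, (a j : ℂ) • c j := by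
  obtain ⟨l, a, c, h1, -, h3, h4, h5⟩ := hJ.exists_isSpectralDecomposition v
  exact ⟨l, a, c, ⟨fun j => (h3 j).1, h4⟩, fun j => (h3 j).2, h1, h5⟩

/-- The Bergman operator at the image of the diastatic exponential is the exponential of
`T(v, v)`. -/
theorem IsPositive.B_radial (hJ : J.IsPositive) {ε : ℝ} (hε : ε ^ 2 = 1) (v : V) :
    J.B (J.radial ε v) (-((ε : ℂ) • J.radial ε v)) =
      funCalc (J.T v v) (fun s => Real.exp (ε * s)) := by
  obtain ⟨l, a, c, hc, h0, -, rfl⟩ := hJ.exists_orthoSystem v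
  refine hJ.ext_of_joint_eigenvectors (fun j => J.isSelfAdj_T (c j)) hc.T_commute
    fun χ u hu0 hu => ?_
  obtain ⟨n, hn, hχ⟩ := hc.joint_eigenvalue hu0 hu
  simp only [hχ] at hu
  have h1 : J.T (∑ j, (a j : ℂ) • c j) (∑ j, (a j : ℂ) • c j) u =
      ((∑ j, (n j : ℝ) * a j ^ 2 : ℝ) : ℂ) • u := by
    rw [hc.T_real, LinearMap.sum_apply, Complex.ofReal_sum, Finset.sum_smul]
    refine Finset.sum_congr rfl fun j _ => ?_
    rw [LinearMap.smul_apply, hu, smul_smul]; push_cast; ring_nf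
  rw [funCalc_apply h1, hc.radial_sum h0, hc.B_apply_of_joint _ hε hn hu]
  congr 1
  rw [Finset.mul_sum, Real.exp_sum, Complex.ofReal_prod]
  refine Finset.prod_congr rfl fun j _ => ?_
  rw [show ε * (n j * a j ^ 2) = n j * (ε * a j ^ 2) by ring, Real.exp_nat_mul]
  -- The radial profile is designed for this: each factor of the Bergman product becomes an
  -- exponential.
  have h2 : 1 + ε * (√(expQuot (ε * a j ^ 2)) * a j) ^ 2 = Real.exp (ε * a j ^ 2) := by
    rw [mul_pow, Real.sq_sqrt (expQuot_pos _).le, expQuot_mul_sq hε]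
    linear_combination (Real.exp (ε * a j ^ 2) - 1) * hε
  rw [← h2]
  push_cast
  rfl

end Radial

end HermitianJordanTriple


/-! ### Smoothness of the radial map -/

open Filter Topology in
/-- The squaring map of a finite-dimensional algebra has smooth local inverses. -/
theorem exists_contDiffAt_sqrt {A : Type*} [NormedRing A] [NormedAlgebra ℂ A]
    [FiniteDimensional ℂ A] {S : A} (hS : ∀ Y, S * Y + Y * S = 0 → Y = 0) :
    ∃ g : A → A, ContDiffAt ℂ ∞ g (S * S) ∧ g (S * S) = S ∧
      ∀ᶠ P in 𝓝 (S * S), g P * g P = P := by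
  have : CompleteSpace A := FiniteDimensional.complete ℂ A
  let f : A → A := fun X => X * X
  let f' : A →L[ℂ] A := (ContinuousLinearMap.mul ℂ A S) + (ContinuousLinearMap.mul ℂ A).flip S
  have hf' : HasFDerivAt f f' S := by
    have h := (hasFDerivAt_id (𝕜 := ℂ) S).mul' (hasFDerivAt_id (𝕜 := ℂ) S)
    refine h.congr_fderiv ?_
    ext Y; simp [f']
  -- The derivative of the square at S is Y ↦ SY + YS; the hypothesis makes it invertible.
  have hinj : Function.Injective f' := by
    rw [injective_iff_map_eq_zero]
    intro Y hY; exact hS Y (by simpa [f'] using hY)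
  let e : A ≃L[ℂ] A := (LinearEquiv.ofInjectiveEndo (f' : A →ₗ[ℂ] A) hinj).toContinuousLinearEquiv
  have he : (e : A →L[ℂ] A) = f' := by ext Y; rfl
  rw [← he] at hf'
  have hc : ContDiffAt ℂ ∞ f S := contDiffAt_id.mul contDiffAt_id
  have h0 : (∞ : WithTop ℕ∞) ≠ 0 := by simp
  refine ⟨hc.localInverse hf' h0, hc.to_localInverse hf' h0, hc.localInverse_apply_image hf' h0,
    (hc.hasStrictFDerivAt' hf' h0).eventually_right_inverse⟩

/-- The coefficients of the entire function `(exp s - 1) / s`. -/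
def expQuotCoeff (n : ℕ) : ℂ := ((n + 1).factorial : ℂ)⁻¹

theorem radius_expQuotCoeff (A : Type*) [NormedRing A] [NormedAlgebra ℂ A] :
    (FormalMultilinearSeries.ofScalars A expQuotCoeff).radius = ⊤ := by
  apply FormalMultilinearSeries.ofScalars_radius_eq_top_of_tendsto
  · exact Filter.Eventually.of_forall fun n => inv_ne_zero (by exact_mod_cast Nat.factorial_ne_zero _)
  · have h : ∀ n : ℕ, ‖expQuotCoeff n.succ‖ / ‖expQuotCoeff n‖ = 1 / ((n + 1 : ℕ) + 1 : ℝ) := by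
      intro n
      have h1 : ((n + 1).factorial : ℝ) ≠ 0 := by exact_mod_cast Nat.factorial_ne_zero _
      rw [expQuotCoeff, expQuotCoeff, Nat.succ_eq_add_one, Nat.factorial_succ (n + 1)]
      rw [norm_inv, norm_inv, Complex.norm_natCast, Complex.norm_natCast]
      push_cast
      field_simp
    simp only [h]
    exact (tendsto_one_div_add_atTop_nhds_zero_nat (𝕜 := ℝ)).comp (Filter.tendsto_add_atTop_nat 1)

/-- The entire function `(exp s - 1) / s` in a Banach algebra. -/
def expQuotSeries {A : Type*} [NormedRing A] [NormedAlgebra ℂ A] : A → A :=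
  FormalMultilinearSeries.ofScalarsSum expQuotCoeff

section

variable {A : Type*} [NormedRing A] [NormedAlgebra ℂ A] [CompleteSpace A]

theorem hasFPowerSeriesOnBall_expQuotSeries :
    HasFPowerSeriesOnBall (expQuotSeries (A := A))
      (FormalMultilinearSeries.ofScalars A expQuotCoeff) 0 ⊤ := by
  have := (FormalMultilinearSeries.ofScalars A expQuotCoeff).hasFPowerSeriesOnBall
    (by rw [radius_expQuotCoeff]; exact ENNReal.zero_lt_top)
  rwa [radius_expQuotCoeff] at this

theorem contDiff_expQuotSeries : ContDiff ℂ ∞ (expQuotSeries (A := A)) := by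
  rw [contDiff_iff_contDiffAt]
  intro a
  exact (hasFPowerSeriesOnBall_expQuotSeries.analyticAt_of_mem (by simp)).contDiffAt

theorem hasSum_expQuotSeries (a : A) :
    HasSum (fun n => expQuotCoeff n • a ^ n) (expQuotSeries a) := by
  have := hasFPowerSeriesOnBall_expQuotSeries.hasSum (y := a) (by simp)
  rw [zero_add] at this
  rwa [FormalMultilinearSeries.ofScalars_apply_eq'] at this

end

theorem expQuotSeries_ofReal (s : ℝ) : expQuotSeries (s : ℂ) = (expQuot s : ℂ) := by
  by_cases hs : s = 0
  · subst hs
    have h := hasSum_expQuotSeries (0 : ℂ)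
    have h2 : HasSum (fun n => expQuotCoeff n • (0 : ℂ) ^ n) (expQuotCoeff 0 • (0 : ℂ) ^ 0) :=
      hasSum_single 0 (fun n hn => by simp [hn])
    rw [expQuot_zero, Complex.ofReal_zero, h.unique h2]
    simp [expQuotCoeff]
  · have h := (hasSum_expQuotSeries (s : ℂ)).mul_left (s : ℂ)
    have h1 : HasSum (fun n => ((n + 1).factorial : ℂ)⁻¹ * (s : ℂ) ^ (n + 1))
        (Complex.exp s - 1) := by
      have h3 := NormedSpace.exp_series_hasSum_exp' (𝕂 := ℂ) (s : ℂ)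
      rw [← Complex.exp_eq_exp_ℂ] at h3
      have h4 := (hasSum_nat_add_iff' 1).2 h3
      simpa only [smul_eq_mul, Finset.range_one, Finset.sum_singleton, Nat.factorial_zero,
        Nat.cast_one, inv_one, pow_zero, mul_one] using h4
    have h2 : (s : ℂ) * expQuotSeries (s : ℂ) = Complex.exp s - 1 := by
      have h6 : (fun n => (s : ℂ) * (expQuotCoeff n • (s : ℂ) ^ n)) =
          fun n => ((n + 1).factorial : ℂ)⁻¹ * (s : ℂ) ^ (n + 1) := by
        funext n
        rw [expQuotCoeff, smul_eq_mul, pow_succ]; ring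
      rw [h6] at h
      exact h.unique h1
    have h5 : (s : ℂ) * (expQuot s : ℂ) = Complex.exp s - 1 := by
      have := mul_expQuot s
      exact_mod_cast this
    exact mul_left_cancel₀ (by exact_mod_cast hs) (h2.trans h5.symm)

namespace HermitianJordanTriple

variable {V : Type*} [NormedAddCommGroup V] [NormedSpace ℂ V] [FiniteDimensional ℂ V]
  (J : HermitianJordanTriple V)

open Filter Topology

theorem expQuotSeries_apply {X : V →L[ℂ] V} {s : ℝ} {u : V} (h : X u = (s : ℂ) • u) :
    expQuotSeries X u = (expQuot s : ℂ) • u := by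
  have : CompleteSpace V := FiniteDimensional.complete ℂ V
  have h1 := (ContinuousLinearMap.apply ℂ V u).hasSum (hasSum_expQuotSeries X)
  have h2 := (hasSum_expQuotSeries (s : ℂ)).smul_const u
  rw [expQuotSeries_ofReal] at h2
  refine h1.unique ?_
  convert h2 using 2 with n
  have hpow : (X ^ n) u = (s : ℂ) ^ n • u := by
    induction n with
    | zero => simp
    | succ n ih =>
      rw [pow_succ, mul_apply_eq_comp, h, map_smul, ih, smul_smul, pow_succ, mul_comm]
  change (expQuotCoeff n • X ^ n) u = _
  rw [smul_apply, hpow, smul_assoc]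

/-- `T` as a continuous real bilinear map. -/
def TL : V →L[ℝ] V →L[ℝ] (V →L[ℂ] V) :=
  (LinearMap.mk₂ ℝ (fun x y => LinearMap.toContinuousLinearMap (J.T x y))
    (fun x x' y => by rw [T_add_left, map_add])
    (fun a x y => by
      rw [← Complex.coe_smul, T_smul_left, map_smul, Complex.coe_smul])
    (fun x y y' => by rw [T_add_right, map_add])
    (fun a x y => by
      rw [← Complex.coe_smul, T_smul_right, Complex.conj_ofReal, map_smul,
        Complex.coe_smul])).toContinuousBilinearMap

theorem TL_apply (x y : V) : J.TL x y = LinearMap.toContinuousLinearMap (J.T x y) := rfl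

theorem contDiff_halfT :
    ContDiff ℝ ∞ (fun v => LinearMap.toContinuousLinearMap (J.halfT v)) := by
  have h : (fun v => LinearMap.toContinuousLinearMap (J.halfT v)) =
      fun v => (1 / 2 : ℂ) • J.TL v v := by
    funext v; rw [halfT, map_smul, TL_apply]
  rw [h]
  exact (J.TL.isBoundedBilinearMap.contDiff.comp (contDiff_id.prodMk contDiff_id)).const_smul _

theorem continuous_form : Continuous fun p : V × V => J.form p.1 p.2 := by
  have h : (fun p : V × V => J.form p.1 p.2) =
      fun p => ((LinearMap.trace ℂ V) ∘ₗ (ContinuousLinearMap.coeLM ℂ)) (J.TL p.1 p.2) := by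
    funext p; rfl
  rw [h]
  exact (LinearMap.continuous_of_finiteDimensional _).comp J.TL.isBoundedBilinearMap.continuous

/-- A form which is positive on the unit sphere stays so under a small perturbation. -/
theorem eventually_form_pos {X : Type*} [TopologicalSpace X] {f : X → V →L[ℂ] V}
    (hf : Continuous f) {x₀ : X} (h : ∀ u, u ≠ 0 → 0 < (J.form (f x₀ u) u).re) :
    ∀ᶠ x in 𝓝 x₀, ∀ u, u ≠ 0 → 0 < (J.form (f x u) u).re := by
  let N : Set (X × V) := {p | 0 < (J.form (f p.1 p.2) p.2).re}
  have hN : IsOpen N := by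
    refine isOpen_lt continuous_const (Complex.continuous_re.comp ?_)
    refine J.continuous_form.comp (Continuous.prodMk ?_ continuous_snd)
    exact (hf.comp continuous_fst).clm_apply continuous_snd
  have : ProperSpace V := FiniteDimensional.proper ℂ V
  obtain ⟨U, W, hU, -, hxU, hW, hUW⟩ := generalized_tube_lemma (isCompact_singleton (x := x₀))
    (isCompact_sphere (0 : V) 1) hN (by
      rintro ⟨x, u⟩ ⟨hx, hu⟩
      obtain rfl : x = x₀ := hx
      refine h u fun h0 => ?_
      have h0' : u = 0 := h0
      simp [h0'] at hu)
  filter_upwards [hU.mem_nhds (hxU rfl)] with x hx u hu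
  have hu' : (‖u‖ : ℂ) ≠ 0 := by exact_mod_cast norm_ne_zero_iff.2 hu
  -- Compactness of the sphere made the neighbourhood uniform in the direction; homogeneity does the
  -- rest.
  have h1 : ((‖u‖ : ℂ))⁻¹ • u ∈ Metric.sphere (0 : V) 1 := by
    rw [mem_sphere_zero_iff_norm, norm_smul, norm_inv, Complex.norm_real, norm_norm,
      inv_mul_cancel₀ (norm_ne_zero_iff.2 hu)]
  have h2 : (x, ((‖u‖ : ℂ))⁻¹ • u) ∈ N := hUW ⟨hx, hW h1⟩
  have h3 : 0 < (J.form (f x (((‖u‖ : ℂ))⁻¹ • u)) (((‖u‖ : ℂ))⁻¹ • u)).re := h2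
  rw [map_smul, form_smul_left, form_smul_right, ← Complex.ofReal_inv, Complex.conj_ofReal,
    ← mul_assoc, ← Complex.ofReal_mul, Complex.re_ofReal_mul] at h3
  exact pos_of_mul_pos_right h3 (mul_self_nonneg _)

theorem commute_funCalc {X Y : V →ₗ[ℂ] V} (h : Commute Y X) (f : ℝ → ℝ) :
    Commute Y (funCalc X f) := by
  rw [funCalc, Polynomial.aeval_eq_sum_range]
  exact Commute.sum_right _ _ _ fun i _ => (h.pow_right i).smul_right _

variable {J}

/-- The operators `X` and `S` agree if they are commuting square roots of the same operator and
have positive real part. -/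
theorem eq_of_sq_eq {X S : V →ₗ[ℂ] V} (h : X * X = S * S) (hc : X * S = S * X)
    (hX : ∀ u, u ≠ 0 → 0 < (J.form (X u) u).re) (hS : ∀ u, u ≠ 0 → 0 < (J.form (S u) u).re) :
    X = S := by
  have hinj : Function.Injective (X + S) := by
    rw [injective_iff_map_eq_zero]
    intro u hu
    by_contra h0
    have h1 : J.form ((X + S) u) u = 0 := by rw [hu, form_zero_left]
    rw [LinearMap.add_apply, form_add_left] at h1
    have h2 := congrArg Complex.re h1
    rw [Complex.add_re, Complex.zero_re] at h2
    linarith [hX u h0, hS u h0]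
  have hsurj := LinearMap.injective_iff_surjective.1 hinj
  -- X + S is invertible by positivity, and the factorization uses that X and S commute.
  have h0 : (X - S) * (X + S) = 0 := by
    rw [sub_mul, mul_add, mul_add, h, hc]; abel
  ext u
  obtain ⟨w, rfl⟩ := hsurj u
  have := LinearMap.congr_fun h0 w
  rw [Module.End.mul_apply, LinearMap.sub_apply, LinearMap.zero_apply] at this
  exact sub_eq_zero.1 this

/-- Interpolation nodes jump with v, so smoothness is not visible from the definition. The square of
the operator is a power series in T(v, v)/2, and near each point the operator coincides with a
smooth local square root. -/
theorem IsPositive.contDiff_funCalc (hJ : J.IsPositive) (ε : ℝ) :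
    ContDiff ℝ ∞ (fun v => LinearMap.toContinuousLinearMap
      (funCalc (J.halfT v) (fun s => √(expQuot (ε * s))))) := by
  have hV : CompleteSpace V := FiniteDimensional.complete ℂ V
  let τ : (V →ₗ[ℂ] V) →ₗ[ℂ] (V →L[ℂ] V) := LinearMap.toContinuousLinearMap.toLinearMap
  let S : V → V →ₗ[ℂ] V := fun v => funCalc (J.halfT v) (fun s => √(expQuot (ε * s)))
  let P : V → V →L[ℂ] V := fun v => expQuotSeries ((ε : ℂ) • LinearMap.toContinuousLinearMap (J.halfT v))
  have hP : ContDiff ℝ ∞ P :=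
    (contDiff_expQuotSeries.restrict_scalars ℝ).comp (J.contDiff_halfT.const_smul _)
  have hPeq : ∀ v, ((P v : V →L[ℂ] V) : V →ₗ[ℂ] V) =
      funCalc (J.halfT v) (fun s => expQuot (ε * s)) := by
    intro v
    refine hJ.ext_of_eigenvectors (J.isSelfAdj_halfT v) fun s u _ hu => ?_
    rw [funCalc_apply hu]
    refine expQuotSeries_apply ?_
    rw [smul_apply, LinearMap.coe_toContinuousLinearMap', hu, smul_smul]
    push_cast; rfl
  have hSS : ∀ v, S v * S v = (P v : V →ₗ[ℂ] V) := by
    intro v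
    rw [hPeq, hJ.funCalc_comp (J.isSelfAdj_halfT v)]
    congr; funext s; exact Real.mul_self_sqrt (expQuot_pos _).le
  -- S is a polynomial in P, so it commutes with every square root of P.
  have hSP : ∀ v, S v = funCalc (P v : V →ₗ[ℂ] V) Real.sqrt := by
    intro v
    refine hJ.ext_of_eigenvectors (J.isSelfAdj_halfT v) fun s u _ hu => ?_
    have : (P v : V →ₗ[ℂ] V) u = ((expQuot (ε * s) : ℝ) : ℂ) • u := by
      rw [hPeq, funCalc_apply hu]
    rw [funCalc_apply this, funCalc_apply hu]
  have hSpos : ∀ v u, u ≠ 0 → 0 < (J.form (S v u) u).re := fun v u hu =>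
    (Complex.lt_def.1 (hJ.isPosDef_funCalc (J.isSelfAdj_halfT v)
      (fun s => Real.sqrt_pos.2 (expQuot_pos _)) u hu)).1
  have hSself : ∀ v, J.IsSelfAdj (S v) := fun v => hJ.isSelfAdj_funCalc (J.isSelfAdj_halfT v) _
  rw [contDiff_iff_contDiffAt]
  intro v₀
  -- If Su = su with s > 0, then S(Yu) = -s Yu, which contradicts positivity unless Yu = 0.
  have hS0 : ∀ Y : V →L[ℂ] V, τ (S v₀) * Y + Y * τ (S v₀) = 0 → Y = 0 := by
    intro Y hY
    have : (Y : V →ₗ[ℂ] V) = 0 := by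
      refine hJ.ext_of_eigenvectors (hSself v₀) fun s u hu0 hu => ?_
      have h1 : S v₀ (Y u) + Y (S v₀ u) = 0 := DFunLike.congr_fun hY u
      rw [hu, map_smul] at h1
      have hs : 0 < s := by
        have := hSpos v₀ u hu0
        rw [hu, form_smul_left, Complex.re_ofReal_mul] at this
        exact pos_of_mul_pos_left this (hJ.form_self_re_pos hu0).le
      by_contra h2
      have h3 := hSpos v₀ (Y u) h2
      rw [eq_neg_of_add_eq_zero_left h1, ← neg_smul, form_smul_left, ← Complex.ofReal_neg,
        Complex.re_ofReal_mul] at h3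
      have := hJ.form_self_re_pos h2
      exact absurd h3 (by rw [neg_mul, not_lt]; exact neg_nonpos.2 (mul_nonneg hs.le this.le))
    ext u; exact LinearMap.congr_fun this u
  obtain ⟨g, hg1, hg2, hg3⟩ := exists_contDiffAt_sqrt hS0
  have hP0 : P v₀ = τ (S v₀) * τ (S v₀) := by
    ext u; exact (LinearMap.congr_fun (hSS v₀) u).symm
  rw [← hP0] at hg1 hg2 hg3
  have hgP : ContDiffAt ℝ ∞ (fun v => g (P v)) v₀ :=
    (hg1.restrict_scalars ℝ).comp v₀ hP.contDiffAt
  refine hgP.congr_of_eventuallyEq ?_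
  have e1 : ∀ᶠ v in 𝓝 v₀, g (P v) * g (P v) = P v := hP.continuous.continuousAt.eventually hg3
  have e2 : ∀ᶠ v in 𝓝 v₀, ∀ u, u ≠ 0 → 0 < (J.form (g (P v) u) u).re := by
    refine hgP.continuousAt.eventually (J.eventually_form_pos (f := fun X => X) continuous_id ?_)
    intro u hu
    simp only [hg2]
    exact hSpos v₀ u hu
  filter_upwards [e1, e2] with v h1 h2
  have h1' : ((g (P v) : V →L[ℂ] V) : V →ₗ[ℂ] V) * (g (P v) : V →ₗ[ℂ] V) = (P v : V →ₗ[ℂ] V) := by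
    ext u; exact DFunLike.congr_fun h1 u
  have h3 : ((g (P v) : V →L[ℂ] V) : V →ₗ[ℂ] V) = S v := by
    refine eq_of_sq_eq (J := J) (h1'.trans (hSS v).symm) ?_ h2 (hSpos v)
    rw [hSP]
    refine commute_funCalc ?_ _
    rw [← h1']; exact (Commute.refl _).mul_right (Commute.refl _)
  ext u
  exact (LinearMap.congr_fun h3 u).symm

theorem IsPositive.contDiff_radial (hJ : J.IsPositive) (ε : ℝ) : ContDiff ℝ ∞ (J.radial ε) :=
  (ContinuousLinearMap.restrictScalarsL ℂ V V ℝ ℝ).contDiff.comp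
    (hJ.contDiff_funCalc ε) |>.clm_apply contDiff_id

theorem radial_zero (ε : ℝ) : J.radial ε 0 = 0 := by
  rw [radial, map_zero]

/-- In the product rule the derivative of the operator is applied to v = 0, and the operator itself
is the identity there. -/
theorem IsPositive.hasFDerivAt_radial (hJ : J.IsPositive) (ε : ℝ) :
    HasFDerivAt (J.radial ε) (ContinuousLinearMap.id ℝ V) 0 := by
  let R := (ContinuousLinearMap.restrictScalarsL ℂ V V ℝ ℝ)
  have h := (R.contDiff.comp (hJ.contDiff_funCalc ε)).differentiable (by simp) 0
  have h2 := h.hasFDerivAt.clm_apply (hasFDerivAt_id (𝕜 := ℝ) (0 : V))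
  refine h2.congr_fderiv ?_
  ext u
  have h3 : J.halfT 0 = 0 := by rw [halfT, T_zero_left, smul_zero]
  have h4 : funCalc (J.halfT (0 : V)) (fun s => √(expQuot (ε * s))) u = u := by
    rw [funCalc_apply (s := 0) (by rw [h3]; simp)]
    simp [expQuot_zero]
  have h5 : R (LinearMap.toContinuousLinearMap (funCalc (J.halfT (0 : V))
      (fun s => √(expQuot (ε * s))))) u = u := h4
  simpa using h5

end HermitianJordanTriple


/-! ### Second derivatives and diagonal operators -/

open Filter Topology in
/-- The second derivative at `0` of a function which is quadratic in a chart tangent to the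
identity. -/
theorem fderiv_fderiv_of_comp_eq {V : Type*} [NormedAddCommGroup V] [NormedSpace ℝ V]
    [CompleteSpace V] {φ : V → ℝ} {E : V → V} (b : V →L[ℝ] V →L[ℝ] ℝ) (hφ : ∀ v, φ (E v) = b v v)
    (hE : ContDiff ℝ ∞ E) (h0 : E 0 = 0) (h1 : HasFDerivAt E (ContinuousLinearMap.id ℝ V) 0)
    (v : V) : fderiv ℝ (fderiv ℝ φ) 0 v v = 2 * b v v := by
  have hn : (∞ : WithTop ℕ∞) ≠ 0 := by simp
  have hc : ContDiffAt ℝ ∞ E 0 := hE.contDiffAt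
  have h1' : HasFDerivAt E ((ContinuousLinearEquiv.refl ℝ V : V ≃L[ℝ] V) : V →L[ℝ] V) 0 := h1
  let G : V → V := hc.localInverse h1' hn
  have hs := hc.hasStrictFDerivAt' h1' hn
  have hG0 : G 0 = 0 := by
    have := hc.localInverse_apply_image h1' hn
    rwa [h0] at this
  have hGc : ContDiffAt ℝ ∞ G 0 := by
    have := hc.to_localInverse h1' hn
    rwa [h0] at this
  have hGd : HasFDerivAt G (ContinuousLinearMap.id ℝ V) 0 := by
    have := hs.to_localInverse.hasFDerivAt
    rwa [h0] at this
  have hEG : ∀ᶠ y in 𝓝 (0 : V), E (G y) = y := by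
    have := hs.eventually_right_inverse
    rwa [h0] at this
  let β : V →L[ℝ] V →L[ℝ] ℝ := b + b.flip
  have hd : ∀ᶠ z in 𝓝 (0 : V), DifferentiableAt ℝ G z := by
    have : ContDiffAt ℝ 1 G 0 := hGc.of_le (by exact_mod_cast le_top)
    filter_upwards [this.eventually (by simp)] with z hz
    exact hz.differentiableAt (by simp)
  -- With G the local inverse of E, the second derivative of G enters only paired with G 0 = 0.
  have hφG : ∀ᶠ z in 𝓝 (0 : V), φ z = b (G z) (G z) := by
    filter_upwards [hEG] with z hz
    rw [← hφ, hz]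
  have hfd : fderiv ℝ φ =ᶠ[𝓝 0] fun z => (β (G z)).comp (fderiv ℝ G z) := by
    filter_upwards [hφG.eventually_nhds, hd] with z hz hdz
    rw [EventuallyEq.fderiv_eq (f := fun z => b (G z) (G z)) hz]
    have h2 := (b.hasFDerivAt.comp z hdz.hasFDerivAt).clm_apply hdz.hasFDerivAt
    refine h2.fderiv.trans ?_
    ext u
    simp [β]
  rw [hfd.fderiv_eq]
  have hG2 : HasFDerivAt (fderiv ℝ G) (fderiv ℝ (fderiv ℝ G) 0) 0 := by
    refine DifferentiableAt.hasFDerivAt ?_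
    exact (hGc.fderiv_right (m := ∞) (mod_cast le_top)).differentiableAt (by simp)
  have h3 := (β.hasFDerivAt.comp 0 hGd).clm_comp hG2
  have h5 : fderiv ℝ G 0 = ContinuousLinearMap.id ℝ V := hGd.fderiv
  rw [show (fun z => (β (G z)).comp (fderiv ℝ G z)) =
    fun z => ((β ∘ G) z).comp (fderiv ℝ G z) from rfl, h3.fderiv]
  simp [hG0, h5, β, two_mul]

section Diagonal

variable {M : Type*} [AddCommGroup M] [Module ℂ M] {ι : Type*} [Fintype ι]

theorem toMatrix_of_eigenbasis [DecidableEq ι] (b : Module.Basis ι ℂ M) {f : M →ₗ[ℂ] M}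
    {d : ι → ℂ} (h : ∀ i, f (b i) = d i • b i) : LinearMap.toMatrix b b f = Matrix.diagonal d := by
  ext i j
  rw [LinearMap.toMatrix_apply, h, map_smul, Finsupp.smul_apply, Module.Basis.repr_self,
    Finsupp.single_apply, Matrix.diagonal_apply]
  by_cases hij : i = j
  · subst hij; simp
  · simp [hij, Ne.symm hij]

theorem det_of_eigenbasis (b : Module.Basis ι ℂ M) {f : M →ₗ[ℂ] M} {d : ι → ℂ}
    (h : ∀ i, f (b i) = d i • b i) : LinearMap.det f = ∏ i, d i := by
  classical
  rw [← LinearMap.det_toMatrix b, toMatrix_of_eigenbasis b h, Matrix.det_diagonal]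

theorem trace_of_eigenbasis (b : Module.Basis ι ℂ M) {f : M →ₗ[ℂ] M} {d : ι → ℂ}
    (h : ∀ i, f (b i) = d i • b i) : LinearMap.trace ℂ M f = ∑ i, d i := by
  classical
  rw [LinearMap.trace_eq_matrix_trace ℂ b, toMatrix_of_eigenbasis b h, Matrix.trace_diagonal]

end Diagonal

namespace HermitianJordanTriple

/-! ### Simple ideals and the Kähler potentials -/

section Ideals

variable {V : Type*} [AddCommGroup V] [Module ℂ V] {J : HermitianJordanTriple V}

theorem T_mem {I : Submodule ℂ V} (hI : J.IsIdeal I) (z w : V) : ∀ x ∈ I, J.T z w x ∈ I := by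
  intro x hx
  rw [T_apply, J.symm]; exact (hI x hx w z).1

/-- T(x, y) maps into the intersection of the two ideals, which is zero by minimality. -/
theorem IsSimpleIdeal.form_eq_zero {I K : Submodule ℂ V} (hI : J.IsSimpleIdeal I)
    (hK : J.IsSimpleIdeal K) (h : I ≠ K) {x y : V} (hx : x ∈ I) (hy : y ∈ K) :
    J.form x y = 0 := by
  have hideal : J.IsIdeal (I ⊓ K) := fun x hx u v =>
    ⟨⟨(hI.1 x hx.1 u v).1, (hK.1 x hx.2 u v).1⟩, ⟨(hI.1 x hx.1 u v).2, (hK.1 x hx.2 u v).2⟩⟩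
  have hbot : I ⊓ K = ⊥ := by
    rcases hI.2.2 _ hideal inf_le_left with h1 | h1
    · exact h1
    · rcases hK.2.2 I hI.1 (inf_eq_left.1 h1) with h2 | h2
      · exact absurd h2 hI.2.1
      · exact absurd h2 h
  have hT : J.T x y = 0 := by
    ext u
    have : J.T x y u ∈ I ⊓ K := ⟨(hI.1 x hx y u).1, (hK.1 y hy x u).2⟩
    rwa [hbot, Submodule.mem_bot] at this
  rw [form, hT, map_zero]

/-- Orthogonality makes the simple ideals independent. Finiteness matters because the potentials are
`finsum`s, which default to 0 on infinite support. -/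
theorem IsPositive.finite_simpleIdeal [FiniteDimensional ℂ V] (hJ : J.IsPositive) :
    Finite {I : Submodule ℂ V // J.IsSimpleIdeal I} := by
  refine WellFoundedGT.finite_of_iSupIndep
    (t := fun I : {I : Submodule ℂ V // J.IsSimpleIdeal I} => I.1) ?_ fun I => I.2.2.1
  intro I
  rw [Submodule.disjoint_def]
  intro x hx hx'
  by_contra h0
  have key : ∀ y ∈ ⨆ j, ⨆ (_ : j ≠ I), (j : Submodule ℂ V), J.form y x = 0 := by
    intro y hy
    refine Submodule.iSup_induction _ (motive := fun y => J.form y x = 0) hy ?_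
      (J.form_zero_left x) fun a b ha hb => by rw [form_add_left, ha, hb, add_zero]
    intro j a ha
    by_cases hj : j = I
    · simp [hj] at ha; simp [ha, form_zero_left]
    · simp only [iSup_pos (show j ≠ I from hj)] at ha
      exact j.2.form_eq_zero I.2 (fun h => hj (Subtype.ext h)) ha hx
  exact (hJ x h0).ne' (key x hx')

variable [FiniteDimensional ℂ V]

theorem IsPositive.det_B_restrict (hJ : J.IsPositive) {I : Submodule ℂ V} (hI : J.IsIdeal I)
    {z w v : V} {ε : ℝ} (hB : J.B z w = funCalc (J.T v v) (fun s => Real.exp (ε * s))) :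
    LinearMap.det ((J.B z w).restrict (J.B_mem hI z w)) =
      Complex.exp (ε * LinearMap.trace ℂ I ((J.T v v).restrict (T_mem hI v v))) := by
  obtain ⟨n, b, μ, hb⟩ := hJ.exists_eigenbasis (J.isSelfAdj_T v) I (T_mem hI v v)
  rw [det_of_eigenbasis b (d := fun i => ((Real.exp (ε * μ i) : ℝ) : ℂ)),
    trace_of_eigenbasis b (d := fun i => (μ i : ℂ)), Finset.mul_sum, Complex.exp_sum]
  · push_cast; rfl
  · intro i; exact Subtype.ext (hb i)
  · intro i
    refine Subtype.ext ?_
    have : J.B z w (b i) = ((Real.exp (ε * μ i) : ℝ) : ℂ) • (b i : V) := by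
      rw [hB, funCalc_apply (hb i)]
    exact this

theorem IsPositive.kernel_radial (hJ : J.IsPositive)
    (I : {I : Submodule ℂ V // J.IsSimpleIdeal I}) (v : V) :
    J.kernel I (J.radial (-1) v) (J.radial (-1) v) =
      Complex.exp (LinearMap.trace ℂ I.1 ((J.T v v).restrict (T_mem I.2.1 v v))) := by
  have hB := hJ.B_radial (ε := -1) (by norm_num) v
  rw [show -(((-1 : ℝ) : ℂ) • J.radial (-1) v) = J.radial (-1) v by simp] at hB
  rw [kernel, hJ.det_B_restrict I.2.1 hB, ← Complex.exp_neg]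
  simp

theorem IsPositive.dualKernel_radial (hJ : J.IsPositive)
    (I : {I : Submodule ℂ V // J.IsSimpleIdeal I}) (v : V) :
    J.dualKernel I (J.radial 1 v) (J.radial 1 v) =
      Complex.exp (LinearMap.trace ℂ I.1 ((J.T v v).restrict (T_mem I.2.1 v v))) := by
  have hB := hJ.B_radial (ε := 1) (by norm_num) v
  rw [show -(((1 : ℝ) : ℂ) • J.radial 1 v) = -J.radial 1 v by simp] at hB
  rw [dualKernel, kernel, inv_inv, hJ.det_B_restrict I.2.1 hB]
  simp

/-- The potentials, read in the chart given by the diastatic exponentials, are values of a linear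
functional at `T(v, v)`. -/
theorem IsPositive.exists_weight (hJ : J.IsPositive) : ∃ wt : (V →ₗ[ℂ] V) →+ ℝ,
    (∀ (a : ℝ) X, wt ((a : ℂ) • X) = a * wt X) ∧
    ∀ v, (J.hypPotential (J.radial (-1) v) (J.radial (-1) v)).re = wt (J.T v v) ∧
      (J.fsPotential (J.radial 1 v) (J.radial 1 v)).re = wt (J.T v v) := by
  have := hJ.finite_simpleIdeal
  have := Fintype.ofFinite {I : Submodule ℂ V // J.IsSimpleIdeal I}
  -- Projections onto the ideals make the trace over I a linear functional of every operator, not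
  -- only of those preserving I.
  choose p hp using fun I : Submodule ℂ V =>
    I.subtype.exists_leftInverse_of_injective I.ker_subtype
  let wt : (V →ₗ[ℂ] V) →+ ℝ :=
    { toFun := fun X => ∑ I : {I : Submodule ℂ V // J.IsSimpleIdeal I},
        (J.genus I.1)⁻¹ * (LinearMap.trace ℂ I.1 (p I.1 ∘ₗ X ∘ₗ I.1.subtype)).re
      map_zero' := by simp
      map_add' := fun X Y => by
        rw [← Finset.sum_add_distrib]
        refine Finset.sum_congr rfl fun I _ => ?_
        rw [LinearMap.add_comp, LinearMap.comp_add, map_add, Complex.add_re, mul_add] }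
  have hres : ∀ (I : {I : Submodule ℂ V // J.IsSimpleIdeal I}) v,
      (J.T v v).restrict (T_mem I.2.1 v v) = p I.1 ∘ₗ J.T v v ∘ₗ I.1.subtype := by
    intro I v
    ext x
    have h1 := LinearMap.congr_fun (hp I.1) ⟨J.T v v x, T_mem I.2.1 v v x x.2⟩
    exact congrArg Subtype.val h1.symm
  -- The real part of the logarithm does not depend on the branch.
  have hre : ∀ (g : ℝ) (t : ℂ), ((g : ℂ)⁻¹ * Complex.log (Complex.exp t)).re = g⁻¹ * t.re := by
    intro g t
    rw [← Complex.ofReal_inv, Complex.re_ofReal_mul, Complex.log_re, Complex.norm_exp,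
      Real.log_exp]
  refine ⟨wt, ?_, ?_⟩
  · intro a X
    change ∑ I, _ = a * ∑ I, _
    rw [Finset.mul_sum]
    refine Finset.sum_congr rfl fun I _ => ?_
    rw [LinearMap.smul_comp, LinearMap.comp_smul, map_smul, smul_eq_mul, Complex.re_ofReal_mul]
    ring
  · intro v
    constructor
    · rw [hypPotential, finsum_eq_sum_of_fintype, Complex.re_sum]
      refine Finset.sum_congr rfl fun I _ => ?_
      rw [hJ.kernel_radial, hre, hres]
    · rw [fsPotential, finsum_eq_sum_of_fintype, Complex.re_sum]
      refine Finset.sum_congr rfl fun I _ => ?_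
      rw [hJ.dualKernel_radial, hre, hres]

omit [FiniteDimensional ℂ V] in
theorem kernel_eq_one (I : {I : Submodule ℂ V // J.IsSimpleIdeal I}) {z w : V}
    (h : J.B z w = LinearMap.id) : J.kernel I z w = 1 := by
  have : (J.B z w).restrict (J.B_mem I.2.1 z w) = LinearMap.id := by
    ext x; exact LinearMap.congr_fun h x.1
  rw [kernel, this, LinearMap.det_id, inv_one]

variable (J)

omit [FiniteDimensional ℂ V] in
theorem B_zero_left (w : V) : J.B 0 w = LinearMap.id := by
  ext u; simp [B_apply, Q_apply]

omit [FiniteDimensional ℂ V] in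
theorem B_zero_right (z : V) : J.B z 0 = LinearMap.id := by
  ext u; simp [B_apply, Q_apply]

-- The potential is normalized at 0: since B(0, w) = B(w, 0) = id, all terms with an argument 0
-- vanish.
omit [FiniteDimensional ℂ V] in
theorem diastasis_hypPotential (q : V) :
    diastasis J.hypPotential 0 q = (J.hypPotential q q).re := by
  have h1 : ∀ w, J.hypPotential 0 w = 0 := fun w => by
    simp [hypPotential, kernel_eq_one _ (J.B_zero_left w)]
  have h2 : ∀ w, J.hypPotential w 0 = 0 := fun w => by
    simp [hypPotential, kernel_eq_one _ (J.B_zero_right w)]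
  simp [diastasis, h1, h2]

omit [FiniteDimensional ℂ V] in
theorem diastasis_fsPotential (q : V) :
    diastasis J.fsPotential 0 q = (J.fsPotential q q).re := by
  have h1 : ∀ w, J.fsPotential 0 w = 0 := fun w => by
    simp [fsPotential, dualKernel, kernel_eq_one _ (J.B_zero_left (-w))]
  have h2 : ∀ w, J.fsPotential w 0 = 0 := fun w => by
    have : J.B w (-0) = LinearMap.id := by rw [neg_zero, B_zero_right]
    simp only [fsPotential, dualKernel, kernel_eq_one _ this]
    simp
  simp [diastasis, h1, h2]

end Ideals

/-! ### The diastatic property -/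

section Diastatic

variable {V : Type*} [NormedAddCommGroup V] [NormedSpace ℂ V] [FiniteDimensional ℂ V]
  {J : HermitianJordanTriple V}

/-- In the radial chart the real part of the potential is the form wt T(v, v), which is invariant
under v ↦ iv. So each of the two second derivatives is twice its value, and the factor 1/4 restores
it. -/
theorem IsPositive.kahlerNormSq_eq (hJ : J.IsPositive) {Φ : V → V → ℂ} {ε : ℝ}
    {wt : (V →ₗ[ℂ] V) →+ ℝ} (hwt : ∀ (a : ℝ) X, wt ((a : ℂ) • X) = a * wt X)
    (hΦ : ∀ v, (Φ (J.radial ε v) (J.radial ε v)).re = wt (J.T v v)) (v : V) :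
    kahlerNormSq Φ 0 v = wt (J.T v v) := by
  have : CompleteSpace V := FiniteDimensional.complete ℂ V
  let b : V →L[ℝ] V →L[ℝ] ℝ := (LinearMap.mk₂ ℝ (fun x y => wt (J.T x y))
    (fun x x' y => by rw [T_add_left, map_add])
    (fun a x y => by rw [← Complex.coe_smul, T_smul_left, hwt, smul_eq_mul])
    (fun x y y' => by rw [T_add_right, map_add])
    (fun a x y => by
      rw [← Complex.coe_smul, T_smul_right, Complex.conj_ofReal, hwt,
        smul_eq_mul])).toContinuousBilinearMap
  have h := fderiv_fderiv_of_comp_eq (φ := fun z => (Φ z z).re) b hΦ (hJ.contDiff_radial ε)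
    (radial_zero ε) (hJ.hasFDerivAt_radial ε)
  have hb : ∀ v, b v v = wt (J.T v v) := fun _ => rfl
  have hI : J.T (Complex.I • v) (Complex.I • v) = J.T v v := by
    rw [T_smul_left, T_smul_right, smul_smul, Complex.conj_I]; simp
  rw [kahlerNormSq, h, h, hb, hb, hI]; ring

theorem IsPositive.isDiastaticExp_radial (hJ : J.IsPositive) :
    IsDiastaticExp J.hypPotential (J.radial (-1)) ∧ IsDiastaticExp J.fsPotential (J.radial 1) := by
  obtain ⟨wt, h1, h2⟩ := hJ.exists_weight
  refine ⟨⟨hJ.contDiff_radial _, radial_zero _, hJ.hasFDerivAt_radial _, fun v => ?_⟩,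
    ⟨hJ.contDiff_radial _, radial_zero _, hJ.hasFDerivAt_radial _, fun v => ?_⟩⟩
  · rw [diastasis_hypPotential, (h2 v).1, hJ.kahlerNormSq_eq h1 fun v => (h2 v).1]
  · rw [diastasis_fsPotential, (h2 v).2, hJ.kahlerNormSq_eq h1 fun v => (h2 v).2]

end Diastatic

end HermitianJordanTriple


namespace HermitianJordanTriple

/-! ### Uniqueness of the positive fourth root -/

section PositiveRoot

variable {V : Type*} [AddCommGroup V] [Module ℂ V] [FiniteDimensional ℂ V]
  {J : HermitianJordanTriple V}

omit [FiniteDimensional ℂ V] in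
theorem IsPosDef.isSelfAdj (hJ : J.IsPositive) {S : V →ₗ[ℂ] V} (hS : J.IsPosDef S) :
    J.IsSelfAdj S := by
  intro u v
  have h := conj_of_im_diag_eq_zero (F := fun u v => J.form (S u) v)
    (fun x x' y => by simp only [map_add, form_add_left])
    (fun x y y' => by simp only [form_add_right])
    (fun a x y => by simp only [map_smul, form_smul_left])
    (fun a x y => by simp only [form_smul_right])
    (fun x => by
      by_cases hx : x = 0
      · simp [hx, form_zero_left]
      · exact (Complex.lt_def.1 (hS x hx)).2.symm) v u
  rw [← h, hJ.conj_form]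

/-- A positive definite operator is determined by its fourth power; this makes the root obtained by
choice computable on eigenvectors. -/
theorem IsPosDef.eq_funCalc_pow_four (hJ : J.IsPositive) {S : V →ₗ[ℂ] V} (hS : J.IsPosDef S) :
    S = funCalc (S ^ 4) (fun s => √(√s)) := by
  refine hJ.ext_of_eigenvectors (hS.isSelfAdj hJ) fun s u hu0 hu => ?_
  have hs : 0 < s := by
    have h := (Complex.lt_def.1 (hS u hu0)).1
    rw [hu, form_smul_left, Complex.re_ofReal_mul, Complex.zero_re] at h
    exact pos_of_mul_pos_left h (hJ.form_self_re_pos hu0).le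
  have h4 : (S ^ 4) u = ((s ^ 4 : ℝ) : ℂ) • u := by
    simp only [pow_succ, pow_zero, one_mul, Module.End.mul_apply, hu, map_smul, smul_smul]
    push_cast; ring_nf
  rw [funCalc_apply h4, hu, show s ^ 4 = (s ^ 2) ^ 2 by ring, Real.sqrt_sq (sq_nonneg s),
    Real.sqrt_sq hs.le]

end PositiveRoot

/-! ### The domain, bijectivity and the duality map -/

variable {V : Type*} [NormedAddCommGroup V] [NormedSpace ℂ V] [FiniteDimensional ℂ V]
  {J : HermitianJordanTriple V}

theorem IsPositive.B_self_radial (hJ : J.IsPositive) (v : V) :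
    J.B (J.radial (-1) v) (J.radial (-1) v) = funCalc (J.T v v) (fun s => Real.exp (-s)) := by
  have hB := hJ.B_radial (ε := -1) (by norm_num) v
  rw [show -(((-1 : ℝ) : ℂ) • J.radial (-1) v) = J.radial (-1) v by simp] at hB
  simpa only [neg_one_mul] using hB

omit [FiniteDimensional ℂ V] in
theorem IsPositive.zero_mem (hJ : J.IsPositive) : (0 : V) ∈ {u : V | J.IsPosDef (J.B u u)} := by
  intro u hu
  rw [B_zero_left]; exact hJ u hu

theorem IsPositive.radial_mem_domain (hJ : J.IsPositive) (v : V) : J.radial (-1) v ∈ J.domain := by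
  have h1 : IsPreconnected (Set.range (J.radial (-1))) :=
    isPreconnected_range (hJ.contDiff_radial (-1)).continuous
  have h2 : Set.range (J.radial (-1)) ⊆ {u : V | J.IsPosDef (J.B u u)} := by
    rintro _ ⟨v, rfl⟩
    change J.IsPosDef _
    rw [hJ.B_self_radial]
    exact hJ.isPosDef_funCalc (J.isSelfAdj_T v) fun s => Real.exp_pos _
  exact h1.subset_connectedComponentIn ⟨0, radial_zero _⟩ h2 ⟨v, rfl⟩

omit [FiniteDimensional ℂ V] in
theorem isPosDef_of_mem_domain {z : V} (hz : z ∈ J.domain) : J.IsPosDef (J.B z z) :=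
  connectedComponentIn_subset _ _ hz

omit [FiniteDimensional ℂ V] in
theorem IsOrthoSystem.halfT_apply {l : ℕ} {c : Fin l → V} (hc : J.IsOrthoSystem c)
    (a : Fin l → ℝ) (i : Fin l) :
    J.halfT (∑ j, (a j : ℂ) • c j) (c i) = ((a i ^ 2 : ℝ) : ℂ) • c i := by
  rw [halfT, LinearMap.smul_apply, hc.T_sum_sum_apply, smul_smul, Complex.conj_ofReal]
  congr 1; push_cast; ring

omit [FiniteDimensional ℂ V] in
theorem IsOrthoSystem.B_self_apply {l : ℕ} {c : Fin l → V} (hc : J.IsOrthoSystem c)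
    (a : Fin l → ℝ) (i : Fin l) :
    J.B (∑ j, (a j : ℂ) • c j) (∑ j, (a j : ℂ) • c j) (c i) =
      (((1 - a i ^ 2) ^ 2 : ℝ) : ℂ) • c i := by
  -- The tripotent c_i has Peirce eigenvalue 2 for itself and 0 for the others.
  have h := hc.B_apply_of_joint a (ε := -1) (by norm_num) (n := fun j => if j = i then 2 else 0)
    (by simp) (u := c i) (fun j => by
      by_cases h : j = i
      · subst h
        have h' : J.tp (c j) (c j) (c j) = (2 : ℂ) • c j := hc.1 j
        simpa [T_apply] using h'
      · simpa [h, T_apply] using hc.tp_same_ne (Ne.symm h))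
  rw [show ∀ z : V, -(((-1 : ℝ) : ℂ) • z) = z by intro z; simp] at h
  rw [h]
  congr 1
  rw [Finset.prod_eq_single i (fun j _ hj => by simp [hj]) (by simp)]
  simp only [if_true]; push_cast; ring

theorem IsPositive.isPosDef_one_sub_halfT (hJ : J.IsPositive) {l : ℕ} {c : Fin l → V}
    (hc : J.IsOrthoSystem c) {a : Fin l → ℝ} (ha : ∀ j, a j ^ 2 < 1) :
    J.IsPosDef (1 - J.halfT (∑ j, (a j : ℂ) • c j)) := by
  have h : 1 - J.halfT (∑ j, (a j : ℂ) • c j) =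
      -- The spectrum lies below 1, as the eigenvalues are ½ Σ n_j a_j² with Σ n_j ≤ 2; the value 1
      -- elsewhere only makes the function positive on all of ℝ.
      funCalc (J.halfT (∑ j, (a j : ℂ) • c j)) (fun s => if s < 1 then 1 - s else 1) := by
    refine hJ.ext_of_joint_eigenvectors (fun j => J.isSelfAdj_T (c j)) hc.T_commute
      fun χ u hu0 hu => ?_
    obtain ⟨n, hn, hχ⟩ := hc.joint_eigenvalue hu0 hu
    simp only [hχ] at hu
    have h1 : J.halfT (∑ j, (a j : ℂ) • c j) u =
        ((1 / 2 * ∑ j, (n j : ℝ) * a j ^ 2 : ℝ) : ℂ) • u := by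
      rw [halfT, LinearMap.smul_apply, hc.T_real, LinearMap.sum_apply, Complex.ofReal_mul,
        mul_smul, Complex.ofReal_sum, Finset.sum_smul]
      push_cast
      refine congrArg _ (Finset.sum_congr rfl fun j _ => ?_)
      rw [LinearMap.smul_apply, hu, smul_smul]; ring_nf
    have hlt : 1 / 2 * ∑ j, (n j : ℝ) * a j ^ 2 < 1 := by
      by_cases hn0 : ∀ j, n j = 0
      · simp [hn0]
      · push Not at hn0
        obtain ⟨k, hk⟩ := hn0
        have h2 : ∑ j, (n j : ℝ) * a j ^ 2 < ∑ j, (n j : ℝ) := by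
          refine Finset.sum_lt_sum (fun j _ => ?_) ⟨k, Finset.mem_univ _, ?_⟩
          · exact mul_le_of_le_one_right (Nat.cast_nonneg _) (ha j).le
          · exact mul_lt_of_lt_one_right (by exact_mod_cast Nat.pos_of_ne_zero hk) (ha k)
        have h3 : ∑ j, (n j : ℝ) ≤ 2 := by exact_mod_cast hn
        linarith
    rw [funCalc_apply h1, if_pos hlt, LinearMap.sub_apply, h1, Module.End.one_apply]
    push_cast
    rw [sub_smul, one_smul]
  rw [h]
  refine hJ.isPosDef_funCalc (J.isSelfAdj_halfT _) fun s => ?_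
  split_ifs with hs
  · linarith
  · exact one_pos

-- B(z, z) has eigenvalue (1 - a_j²)² on c_j, so its positivity alone allows a_j > 1. The domain is
-- covered by two disjoint open sets, where 1 - T(z, z)/2 is positive definite or takes a negative
-- value; being connected and containing 0, it lies in the first.
open Filter Topology in
theorem IsPositive.form_one_sub_halfT_pos (hJ : J.IsPositive) {z : V} (hz : z ∈ J.domain) {u : V}
    (hu : u ≠ 0) : 0 < (J.form ((1 - J.halfT z) u) u).re := by
  have hcont : Continuous fun z => LinearMap.toContinuousLinearMap (1 - J.halfT z) := by
    simp only [map_sub]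
    exact continuous_const.sub J.contDiff_halfT.continuous
  let U₁ : Set V := {z | ∀ u, u ≠ 0 → 0 < (J.form ((1 - J.halfT z) u) u).re}
  let U₂ : Set V := {z | ∃ u, (J.form ((1 - J.halfT z) u) u).re < 0}
  have h1 : IsOpen U₁ := isOpen_iff_mem_nhds.2 fun z hz => J.eventually_form_pos hcont hz
  have h2 : IsOpen U₂ := by
    have : U₂ = ⋃ u, {z | (J.form ((1 - J.halfT z) u) u).re < 0} := by
      ext z; simp [U₂]
    rw [this]
    refine isOpen_iUnion fun u => isOpen_lt (Complex.continuous_re.comp ?_) continuous_const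
    exact J.continuous_form.comp ((hcont.clm_apply continuous_const).prodMk continuous_const)
  have hdisj : Disjoint U₁ U₂ := by
    rw [Set.disjoint_left]
    rintro z hz ⟨u, hu⟩
    by_cases h0 : u = 0
    · simp [h0, form_zero_left] at hu
    · exact lt_asymm hu (hz u h0)
  have hcov : J.domain ⊆ U₁ ∪ U₂ := by
    intro z hz
    obtain ⟨l, a, c, hc, h0, ha, rfl⟩ := hJ.exists_orthoSystem z
    by_cases h : ∀ j, a j ^ 2 < 1
    · left
      intro u hu
      exact (Complex.lt_def.1 (hJ.isPosDef_one_sub_halfT hc h u hu)).1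
    · right
      push Not at h
      obtain ⟨j, hj⟩ := h
      have hne : a j ^ 2 ≠ 1 := by
        intro h1
        have := isPosDef_of_mem_domain hz (c j) (h0 j)
        rw [hc.B_self_apply, h1] at this
        simp [form_zero_left] at this
      refine ⟨c j, ?_⟩
      have h3 : (1 - J.halfT (∑ j, (a j : ℂ) • c j)) (c j) = ((1 - a j ^ 2 : ℝ) : ℂ) • c j := by
        rw [LinearMap.sub_apply, hc.halfT_apply, Module.End.one_apply]
        push_cast; rw [sub_smul, one_smul]
      rw [h3, form_smul_left, Complex.re_ofReal_mul]
      exact mul_neg_of_neg_of_pos (by linarith [lt_of_le_of_ne hj (Ne.symm hne)])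
        (hJ.form_self_re_pos (h0 j))
  have hzero : (J.domain ∩ U₁).Nonempty := by
    refine ⟨0, mem_connectedComponentIn hJ.zero_mem, fun u hu => ?_⟩
    rw [halfT, T_zero_left, smul_zero, sub_zero]
    exact hJ.form_self_re_pos hu
  exact isPreconnected_connectedComponentIn.subset_left_of_subset_union h1 h2 hdisj hcov hzero hz
    u hu

theorem IsPositive.lt_one_of_mem_domain (hJ : J.IsPositive) {l : ℕ} {c : Fin l → V}
    (hc : J.IsOrthoSystem c) (h0 : ∀ j, c j ≠ 0) {a : Fin l → ℝ}
    (hz : ∑ j, (a j : ℂ) • c j ∈ J.domain) (j : Fin l) : a j < 1 := by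
  have h1 := hJ.form_one_sub_halfT_pos hz (h0 j)
  have h3 : (1 - J.halfT (∑ j, (a j : ℂ) • c j)) (c j) = ((1 - a j ^ 2 : ℝ) : ℂ) • c j := by
    rw [LinearMap.sub_apply, hc.halfT_apply, Module.End.one_apply]
    push_cast; rw [sub_smul, one_smul]
  rw [h3, form_smul_left, Complex.re_ofReal_mul] at h1
  have h2 := pos_of_mul_pos_left h1 (hJ.form_self_re_pos (h0 j)).le
  nlinarith

theorem IsPositive.surjOn_radial (hJ : J.IsPositive) :
    Set.SurjOn (J.radial (-1)) Set.univ J.domain := by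
  intro z hz
  obtain ⟨l, a, c, hc, h0, ha, rfl⟩ := hJ.exists_orthoSystem z
  have hlt := hJ.lt_one_of_mem_domain hc h0 hz
  -- The solution t of a_j = √(1 - exp(-t²)).
  refine ⟨∑ j, ((√(-Real.log (1 - a j ^ 2)) : ℝ) : ℂ) • c j, trivial, ?_⟩
  rw [hc.radial_sum h0]
  refine Finset.sum_congr rfl fun j _ => ?_
  have hpos : 0 < 1 - a j ^ 2 := by nlinarith [hlt j, ha j]
  have hlog : 0 ≤ -Real.log (1 - a j ^ 2) :=
    neg_nonneg.2 (Real.log_nonpos hpos.le (by nlinarith [ha j]))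
  rw [sqrt_expQuot_mul (by norm_num) (Real.sqrt_nonneg _), Real.sq_sqrt hlog, neg_one_mul (-_), neg_neg,
    Real.exp_log hpos, show -1 * (1 - a j ^ 2 - 1) = a j ^ 2 by ring, Real.sqrt_sq (ha j).le]

/-- The image determines T(v, v) as -log B(z, z), hence the operator applied to v; that operator is
injective. -/
theorem IsPositive.injective_radial (hJ : J.IsPositive) : Function.Injective (J.radial (-1)) := by
  have hT : ∀ v, J.T v v =
      funCalc (J.B (J.radial (-1) v) (J.radial (-1) v)) (fun s => -Real.log s) := by
    intro v
    refine hJ.ext_of_eigenvectors (J.isSelfAdj_T v) fun s u _ hu => ?_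
    have : J.B (J.radial (-1) v) (J.radial (-1) v) u = ((Real.exp (-s) : ℝ) : ℂ) • u := by
      rw [hJ.B_self_radial, funCalc_apply hu]
    rw [funCalc_apply this, Real.log_exp, neg_neg, hu]
  intro v w h
  have h1 : J.halfT v = J.halfT w := by
    rw [halfT, halfT, hT v, hT w, h]
  have h2 : funCalc (J.halfT v) (fun s => √(expQuot (-1 * s))) (v - w) = 0 := by
    rw [map_sub, sub_eq_zero]
    rw [radial, radial, ← h1] at h
    exact h
  by_contra hne
  have h3 := hJ.isPosDef_funCalc (J.isSelfAdj_halfT v)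
    (fun s => Real.sqrt_pos.2 (expQuot_pos (-1 * s))) (v - w) (sub_ne_zero.2 hne)
  rw [h2, form_zero_left] at h3
  exact lt_irrefl _ h3

theorem IsPositive.negFourthRoot_spec (hJ : J.IsPositive) {z : V} (hz : z ∈ J.domain) :
    J.IsPosDef (J.negFourthRoot (J.B z z)) ∧ J.negFourthRoot (J.B z z) ^ 4 * J.B z z = 1 := by
  have h : ∃ S : V →ₗ[ℂ] V, J.IsPosDef S ∧ S ^ 4 * J.B z z = 1 := by
    obtain ⟨v, -, rfl⟩ := hJ.surjOn_radial hz
    -- For z the image of v, B(z, z) = exp(-T(v, v)), so its power -1/4 is exp(T(v, v)/4).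
    refine ⟨funCalc (J.T v v) (fun s => Real.exp (s / 4)),
      hJ.isPosDef_funCalc (J.isSelfAdj_T v) fun s => Real.exp_pos _, ?_⟩
    rw [hJ.B_self_radial]
    refine hJ.ext_of_eigenvectors (J.isSelfAdj_T v) fun s u _ hu => ?_
    simp only [pow_succ, pow_zero, one_mul, Module.End.mul_apply, funCalc_apply hu, map_smul,
      smul_smul, ← Complex.ofReal_mul, ← Real.exp_add, Module.End.one_apply]
    rw [show -s + (s / 4 + (s / 4 + (s / 4 + s / 4))) = 0 by ring, Real.exp_zero]
    simp
  rw [negFourthRoot, dif_pos h]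
  exact h.choose_spec

theorem IsPositive.sympDuality_sum (hJ : J.IsPositive) {l : ℕ} {c : Fin l → V}
    (hc : J.IsOrthoSystem c) (h0 : ∀ j, c j ≠ 0) {a : Fin l → ℝ} (ha : ∀ j, 0 < a j)
    (hz : ∑ j, (a j : ℂ) • c j ∈ J.domain) :
    J.sympDuality (∑ j, (a j : ℂ) • c j) =
      ∑ j, ((a j / √(1 - a j ^ 2) : ℝ) : ℂ) • c j := by
  obtain ⟨h1, h2⟩ := hJ.negFourthRoot_spec hz
  have hlt := hJ.lt_one_of_mem_domain hc h0 hz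
  rw [sympDuality]
  suffices h : ∀ j, J.negFourthRoot (J.B (∑ j, (a j : ℂ) • c j) (∑ j, (a j : ℂ) • c j)) (c j) =
      (((√(1 - a j ^ 2))⁻¹ : ℝ) : ℂ) • c j by
    rw [map_sum]
    refine Finset.sum_congr rfl fun j _ => ?_
    rw [map_smul, h, smul_smul, div_eq_mul_inv, Complex.ofReal_mul]
  intro j
  have hpos : 0 < 1 - a j ^ 2 := by nlinarith [hlt j, ha j]
  generalize J.negFourthRoot (J.B (∑ j, (a j : ℂ) • c j) (∑ j, (a j : ℂ) • c j)) = S at h1 h2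
  have h3 : (S ^ 4) (c j) = (((1 - a j ^ 2)⁻¹ ^ 2 : ℝ) : ℂ) • c j := by
    have h4 := LinearMap.congr_fun h2 (c j)
    rw [Module.End.mul_apply, hc.B_self_apply, map_smul, Module.End.one_apply] at h4
    conv_rhs => rw [← h4, smul_smul, ← Complex.ofReal_mul, ← mul_pow, inv_mul_cancel₀ hpos.ne']
    simp
  rw [h1.eq_funCalc_pow_four hJ, funCalc_apply h3, Real.sqrt_sq (inv_nonneg.2 hpos.le),
    Real.sqrt_inv]

theorem IsPositive.isHypExp_radial (hJ : J.IsPositive) : J.IsHypExp (J.radial (-1)) where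
  mem_domain := hJ.radial_mem_domain
  diastatic := hJ.isDiastaticExp_radial.1
  polydisk l φ hφ v := by
    rw [hφ.radial_apply]
    exact congrArg φ (funext fun k => by rw [polydiskExp_eq])

theorem IsPositive.isFSExp_radial (hJ : J.IsPositive) : J.IsFSExp (J.radial 1) where
  diastatic := hJ.isDiastaticExp_radial.2
  polydisk l φ hφ v := by
    rw [hφ.radial_apply]
    exact congrArg φ (funext fun k => by rw [dualPolydiskExp_eq])

/-- Every vector is tangent to a polydisk through the origin. -/
theorem IsPositive.exists_isPolydisk (hJ : J.IsPositive) (v : V) :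
    ∃ (l : ℕ) (φ : (Fin l → ℂ) →ₗ[ℂ] V) (x : Fin l → ℂ), J.IsPolydisk φ ∧ φ x = v := by
  obtain ⟨l, a, c, hc, h0, -, rfl⟩ := hJ.exists_orthoSystem v
  exact ⟨l, _, fun j => (a j : ℂ), hc.isPolydisk h0, rfl⟩

/-- On each coordinate, √(1 - exp(-a²)) / √(exp(-a²)) = √(exp(a²) - 1). -/
theorem IsPositive.sympDuality_radial (hJ : J.IsPositive) (v : V) :
    J.sympDuality (J.radial (-1) v) = J.radial 1 v := by
  have hmem := hJ.radial_mem_domain v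
  obtain ⟨l, a, c, hc, h0, ha, rfl⟩ := hJ.exists_orthoSystem v
  rw [hc.radial_sum h0] at hmem ⊢
  rw [hJ.sympDuality_sum hc h0 (fun j => mul_pos (Real.sqrt_pos.2 (expQuot_pos _)) (ha j)) hmem,
    hc.radial_sum h0]
  refine Finset.sum_congr rfl fun j _ => ?_
  congr 2
  rw [sqrt_expQuot_mul (by norm_num) (ha j).le, sqrt_expQuot_mul (by norm_num) (ha j).le]
  have h1 : Real.exp (-1 * a j ^ 2) ≤ 1 := Real.exp_le_one_iff.2 (by nlinarith [sq_nonneg (a j)])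
  rw [Real.sq_sqrt (by linarith), ← Real.sqrt_div (by linarith)]
  congr 1
  rw [show 1 - -1 * (Real.exp (-1 * a j ^ 2) - 1) = Real.exp (-1 * a j ^ 2) by ring,
    neg_one_mul (a j ^ 2), Real.exp_neg]
  have := (Real.exp_pos (a j ^ 2)).ne'
  rw [one_mul]
  field_simp
  ring

end HermitianJordanTriple

end

theorem theorem3 {V : Type*} [NormedAddCommGroup V] [NormedSpace ℂ V] [FiniteDimensional ℂ V]
    (J : HermitianJordanTriple V) (hJ : J.IsPositive) :
    (∃ Ehyp EFS : V → V,
      (J.IsHypExp Ehyp ∧ ∀ E : V → V, J.IsHypExp E → E = Ehyp) ∧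
      (J.IsFSExp EFS ∧ ∀ E : V → V, J.IsFSExp E → E = EFS) ∧
      Set.BijOn Ehyp Set.univ J.domain ∧
      Set.EqOn J.sympDuality (EFS ∘ Function.invFunOn Ehyp Set.univ) J.domain) ∧
    (∀ z ∈ J.domain,
      (J.IsPosDef (J.negFourthRoot (J.B z z)) ∧ J.negFourthRoot (J.B z z) ^ 4 * J.B z z = 1) ∧
      (∃ (s : ℕ) (lam : Fin s → ℝ) (c : Fin s → V), J.IsSpectralDecomposition z lam c) ∧
      ∀ (s : ℕ) (lam : Fin s → ℝ) (c : Fin s → V), J.IsSpectralDecomposition z lam c →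
        (∀ j, lam j < 1) ∧
        J.sympDuality z = ∑ j, ((lam j / Real.sqrt (1 - lam j ^ 2) : ℝ) : ℂ) • c j) := by
  refine ⟨⟨J.radial (-1), J.radial 1, ⟨hJ.isHypExp_radial, fun E hE => ?_⟩,
    ⟨hJ.isFSExp_radial, fun E hE => ?_⟩,
    ⟨fun v _ => hJ.radial_mem_domain v, hJ.injective_radial.injOn, hJ.surjOn_radial⟩,
    fun z hz => ?_⟩, fun z hz => ⟨hJ.negFourthRoot_spec hz, hJ.exists_isSpectralDecomposition z,
      fun s lam c h => ?_⟩⟩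
  -- Uniqueness: every v lies in a polydisk, where the value is prescribed.
  · funext v
    obtain ⟨l, φ, x, hφ, rfl⟩ := hJ.exists_isPolydisk v
    rw [hE.polydisk l φ hφ, hJ.isHypExp_radial.polydisk l φ hφ]
  · funext v
    obtain ⟨l, φ, x, hφ, rfl⟩ := hJ.exists_isPolydisk v
    rw [hE.polydisk l φ hφ, hJ.isFSExp_radial.polydisk l φ hφ]
  · rw [Function.comp_apply, ← hJ.sympDuality_radial,
      Function.invFunOn_eq (hJ.surjOn_radial hz)]
  · obtain ⟨h1, -, h3, h4, rfl⟩ := h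
    have hc : J.IsOrthoSystem c := ⟨fun j => (h3 j).1, h4⟩
    exact ⟨hJ.lt_one_of_mem_domain hc (fun j => (h3 j).2) hz,
      hJ.sympDuality_sum hc (fun j => (h3 j).2) h1 hz⟩
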